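/- Let $\Theta=(\theta_k)_{k\ge1}$ be a sequence of strictly positive reals. For $\sigma\in S_N$ let $C_k(\sigma)$ be the number of cycles of $\sigma$ of length $k$, and let $\mathbb P_\Theta$ be the generalized Ewens measure on $S_N$, $$\mathbb P_\Theta[\sigma]=\frac{1}{h_N N!}\prod_{k=1}^N\theta_k^{C_k(\sigma)},\qquad h_N=\frac1{N!}\sum_{\sigma\in S_N}\prod_{k=1}^N\theta_k^{C_k(\sigma)} .$$ Let $r>0$, $\vartheta>0$, $0<\gamma\le1$, and assume that $g_\Theta(t)=\sum_{k\ge1}\frac{\theta_k}{k}t^k$ belongs to the class $e\mathcal F(r,\vartheta,\gamma)$, that is, $g_\Theta$ is holomorphic in $|t|<r$ and $$g_\Theta(t)=\vartheta\log\frac1{1-t/r}+g_0(t),\qquad [t^N][g_0]=O(r^{-N}N^{-1-\gamma})\quad(N\to\infty).$$ Let $z_1,z_2,\dots$ be i.i.d. random variables with values in the unit circle $S^1$, independent of the random permutation $\sigma\in S_N$ with law $\mathbb P_\Theta$. For $F:S^1\to\mathbb C$ put $\mathrm{tr}(F)=\sum_{k=1}^N F(\omega_k)$, where $\omega_1,\dots,\omega_N$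 are the eigenvalues, with multiplicity, of $\mathrm{diag}(z_1,\dots,z_N)\cdot(\delta_{i,\sigma(j)})_{1\le i,j\le N}$, and for $k\ge1$, $y\in S^1$ put $$\Delta_k(F,y)=\frac1k\sum_{\omega^k=y}F(\omega).$$ Let $(Z_{k,m})_{k,m\ge1}$ be independent random variables such that $Z_{k,m}$ is equal in law to $z_1z_2\cdots z_k$, and let $(P_k)_{k\ge1}$ be independent Poisson random variables, independent of $(Z_{k,m})_{k,m\ge1}$, where $P_k$ has parameter $\theta_k r^k/k$. Assume that, for every $k\ge1$, $\Delta_k(F,\cdot)$ is integrable with respect to the law of $Z_{k,1}$, and that $$\sum_{k=1}^\infty k^{(1-\vartheta)_+}\,\mathbb E\bigl[|\Delta_k(F,Z_{k,1})|\bigr]<\infty ,$$ where $x_+=\max(x,0)$. Then the series $$Y=\sum_{k=1}^\infty\sum_{m=1}^{P_k}k\,\Delta_k(F,Z_{k,m})$$ is almost surely absolutely convergent, and $\mathrm{tr}(F)$ converges in law to $Y$ as $N\to\infty$. -/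

import Mathlib

open MeasureTheory ProbabilityTheory Filter Topology

noncomputable section

namespace WreathTrace

/-! ### Generalized Ewens measures -/

/-- The number `C_k(σ)` of cycles of length `k` of `σ`, fixed points being cycles of length `1`. -/
def cycleCount {N : ℕ} (σ : Equiv.Perm (Fin N)) (k : ℕ) : ℕ :=
  σ.partition.parts.count k

/-- The weight `∏_{k=1}^N θ_k ^ C_k(σ)`. -/
def ewensWeight (θ : ℕ → ℝ) {N : ℕ} (σ : Equiv.Perm (Fin N)) : ℝ :=
  ∏ k ∈ Finset.Icc 1 N, θ k ^ cycleCount σ k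

/-- The normalization constant `h_N = (1 / N!) ∑_σ ∏_k θ_k ^ C_k(σ)`. -/
def ewensNorm (θ : ℕ → ℝ) (N : ℕ) : ℝ :=
  (1 / (N.factorial : ℝ)) * ∑ σ : Equiv.Perm (Fin N), ewensWeight θ σ

/-- The circle carries its Borel σ-algebra. -/
instance instMeasurableSpaceCircle : MeasurableSpace Circle := borel Circle

instance instBorelSpaceCircle : BorelSpace Circle := ⟨rfl⟩

/-- All subsets of the finite group of permutations are measurable. -/
instance instMeasurableSpacePerm (N : ℕ) : MeasurableSpace (Equiv.Perm (Fin N)) := ⊤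

/-- The generalized Ewens measure, with
`P_Θ[σ] = (1 / (h_N N!)) ∏_{k=1}^N θ_k ^ C_k(σ)`. -/
def ewensMeasure (θ : ℕ → ℝ) (N : ℕ) : Measure (Equiv.Perm (Fin N)) :=
  ∑ σ : Equiv.Perm (Fin N),
    ENNReal.ofReal (1 / (ewensNorm θ N * (N.factorial : ℝ)) * ewensWeight θ σ) • Measure.dirac σ

/-- The generating series `g_Θ(t) = ∑_{k ≥ 1} (θ_k / k) t^k`. -/
def genSeries (θ : ℕ → ℝ) : PowerSeries ℂ :=
  PowerSeries.mk fun k => if k = 0 then 0 else ((θ k / k : ℝ) : ℂ)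

/-! ### The class `eF(r, ϑ, γ)` -/

/-- A power series `g` belongs to `eF(r, ϑ, γ)`: it converges (to a holomorphic function) in the
disc `|t| < r`, where `g(t) = ϑ log (1 / (1 - t / r)) + g₀(t)` with
`[t^N][g₀] = O(r^{-N} N^{-1-γ})`. -/
structure ClassEF (r ϑ γ : ℝ) (g : PowerSeries ℂ) : Prop where
  r_pos : 0 < r
  theta_nonneg : 0 ≤ ϑ
  gamma_pos : 0 < γ
  gamma_le_one : γ ≤ 1
  summable : ∀ t : ℂ, ‖t‖ < r → Summable fun n : ℕ => PowerSeries.coeff n g * t ^ n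
  expansion : ∃ g₀ : PowerSeries ℂ,
    (∀ t : ℂ, ‖t‖ < r →
      HasSum (fun n : ℕ => PowerSeries.coeff n g₀ * t ^ n)
        ((∑' n : ℕ, PowerSeries.coeff n g * t ^ n) - ϑ * Complex.log (1 / (1 - t / r)))) ∧
    (fun n : ℕ => PowerSeries.coeff n g₀) =O[atTop]
      fun n : ℕ => r ^ (-(n : ℝ)) * (n : ℝ) ^ (-1 - γ)

/-! ### Traces on the wreath product -/

/-- The matrix `M(σ, z_1, …, z_N) = diag(z_1, …, z_N) · (δ_{i, σ(j)})_{i, j}`. -/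
def wreathMatrix {N : ℕ} (σ : Equiv.Perm (Fin N)) (z : Fin N → Circle) :
    Matrix (Fin N) (Fin N) ℂ :=
  Matrix.diagonal (fun i => (z i : ℂ)) * Matrix.of fun i j => if i = σ j then 1 else 0

/-- `tr(F)`: the sum of `F` over the eigenvalues of `M(σ, z_1, …, z_N)` with (algebraic)
multiplicity. The eigenvalues lie on the unit circle since the matrix is unitary, so that the
values of the extension of `F` outside of the circle are irrelevant. -/
def wreathTrace (F : Circle → ℂ) {N : ℕ} (σ : Equiv.Perm (Fin N)) (z : Fin N → Circle) : ℂ :=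
  ((wreathMatrix σ z).charpoly.roots.map
    (Function.extend (fun w : Circle => (w : ℂ)) F 0)).sum

/-- `Δ_k(F, y) = (1 / k) ∑_{ω ^ k = y} F(ω)`; the sum is finite for `k ≥ 1`. -/
def rootAverage (F : Circle → ℂ) (k : ℕ) (y : Circle) : ℂ :=
  (1 / (k : ℂ)) * ∑ᶠ w ∈ {w : Circle | w ^ k = y}, F w

/-- The law of a product of `k` independent random variables, each with law `ρ`. -/
def productLaw (ρ : Measure Circle) (k : ℕ) : Measure Circle :=
  (Measure.pi fun _ : Fin k => ρ).map fun z => ∏ j, z j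

/-- The term `∑_{m=1}^{P_k} k Δ_k(F, Z_{k,m})` of the limit (with `m` running from `0`). -/
def limitTerm {Ω : Type*} (F : Circle → ℂ) (P : ℕ+ → Ω → ℕ) (Z : ℕ+ → ℕ → Ω → Circle)
    (k : ℕ+) (ω : Ω) : ℂ :=
  ∑ m ∈ Finset.range (P k ω), (k : ℂ) * rootAverage F k (Z k m ω)

/-- The limit `Y = ∑_{k ≥ 1} ∑_{m=1}^{P_k} k Δ_k(F, Z_{k,m})`. -/
def limitSum {Ω : Type*} (F : Circle → ℂ) (P : ℕ+ → Ω → ℕ) (Z : ℕ+ → ℕ → Ω → Circle)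
    (ω : Ω) : ℂ :=
  ∑' k : ℕ+, limitTerm F P Z k ω

end WreathTrace

end

/-! The characteristic polynomial of the matrix factors over the cycles of `σ`: a cycle of length
`k` whose entries multiply to `y` contributes `X ^ k - y`. Hence the trace is the sum over the
cycles of `k Δ_k(F, y)` (`wreathTrace_eq_sum`). Given `σ`, the products over distinct cycles are
independent with the laws `productLaw ρ k`. With `φ_k` the characteristic function of `k Δ_k(F,
Z_{k,1})`, the characteristic function of the trace is therefore the Ewens average of `∏_k φ_k ^
C_k`, a quotient of averages over the symmetric group with weights `θ_k φ_k` and `θ_k`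
(`charFun_wreathTrace`).

By the exponential formula (`isExpOf_permAverage`) these averages are the coefficients of
exponentials. After the rescaling `t ↦ r t`, write `H` for the series of the denominators; the
numerators have the series `H exp(C)` with `C_k = (θ_k r^k / k)(φ_k - 1)`. The hypothesis on `g_Θ`
gives `H = (1 - t)^(-ϑ) exp(B)` with `B_k = O(k^(-1-γ))`, whence `H_n` is asymptotic to a nonzero
constant times the coefficient of `(1 - t)^(-ϑ)` (`tendsto_coeff_div_risingCoeff`). So `H_{n-k} /
H_n` tends to `1` for fixed `k` and is at most a constant times `(k + 1)^((1-ϑ)_+)`. Since `|φ_k -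
1| ≤ k |t| E|Δ_k|`, the summability hypothesis is what Tannery's theorem needs, and the quotient
tends to `exp(∑ C_k)` (`tendsto_coeff_div_coeff`, `tendsto_permAverage_div`).

This limit is the compound Poisson characteristic function of `Y` (`charFun_limitSum`), and Lévy's
continuity theorem concludes. -/

namespace WreathTrace

/-! ### Formal exponentials, described by their Euler derivative. -/

open PowerSeries in
/-- `U` is the exponential of the power series whose Euler derivative is `C`. -/
structure IsExpOf (C U : PowerSeries ℂ) : Prop where
  const : constantCoeff U = 1
  euler : X * derivative ℂ U = C * U

namespace IsExpOf

open PowerSeries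

lemma coeff_euler (U : PowerSeries ℂ) (n : ℕ) :
    coeff n (X * derivative ℂ U) = n * coeff n U := by
  cases n with
  | zero => simp
  | succ n => rw [coeff_succ_X_mul, coeff_derivative]; push_cast; ring

lemma recurrence {C U : PowerSeries ℂ} (h : IsExpOf C U) (n : ℕ) :
    (n : ℂ) * coeff n U = ∑ p ∈ Finset.HasAntidiagonal.antidiagonal n, coeff p.1 C * coeff p.2 U := by
  rw [← coeff_euler, h.euler, coeff_mul]

lemma of_recurrence {C U : PowerSeries ℂ} (h0 : coeff 0 U = 1)
    (h : ∀ n : ℕ, (n : ℂ) * coeff n U =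
      ∑ p ∈ Finset.HasAntidiagonal.antidiagonal n, coeff p.1 C * coeff p.2 U) : IsExpOf C U where
  const := by simpa using h0
  euler := by ext n; rw [coeff_euler, h n, coeff_mul]

lemma const_eq_zero {C U : PowerSeries ℂ} (h : IsExpOf C U) : coeff 0 C = 0 := by
  have := h.recurrence 0
  have h1 : coeff 0 U = 1 := by simpa using h.const
  simpa [h1, h.const] using this.symm

/-- Since `C` has no constant term, the recurrence expresses `n U_n` through coefficients of smaller
index. This is how product formulas between exponentials are obtained without formal logarithms. -/
lemma unique {C U V : PowerSeries ℂ} (hU : IsExpOf C U) (hV : IsExpOf C V) : U = V := by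
  ext n
  induction n using Nat.strong_induction_on with
  | _ n ih =>
    rcases Nat.eq_zero_or_pos n with rfl | hn
    · simpa using hU.const.trans hV.const.symm
    · have hn' : (n : ℂ) ≠ 0 := by exact_mod_cast hn.ne'
      apply mul_left_cancel₀ hn'
      rw [hU.recurrence, hV.recurrence]
      refine Finset.sum_congr rfl fun p hp => ?_
      rw [Finset.HasAntidiagonal.mem_antidiagonal] at hp
      rcases Nat.eq_zero_or_pos p.1 with h0 | h0
      · rw [h0, hU.const_eq_zero]; simp
      · rw [ih p.2 (by omega)]

lemma mul {C D U V : PowerSeries ℂ} (hU : IsExpOf C U) (hV : IsExpOf D V) :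
    IsExpOf (C + D) (U * V) where
  const := by simp [hU.const, hV.const]
  euler := by
    have h1 := hU.euler
    have h2 := hV.euler
    rw [Derivation.leibniz, smul_eq_mul, smul_eq_mul]
    calc X * (U * derivative ℂ V + V * derivative ℂ U)
        = U * (X * derivative ℂ V) + V * (X * derivative ℂ U) := by ring
      _ = _ := by rw [h1, h2]; ring

lemma exp_subst {B : PowerSeries ℂ} (hB : constantCoeff B = 0) :
    IsExpOf (X * derivative ℂ B) ((exp ℂ).subst B) where
  const := by
    rw [← coeff_zero_eq_constantCoeff_apply,
      coeff_subst' (HasSubst.of_constantCoeff_zero' hB), finsum_eq_single _ 0]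
    · simp
    · intro n hn; simp [hB, hn]
  euler := by
    rw [derivative_subst (HasSubst.of_constantCoeff_zero' hB), derivative_exp]
    ring

end IsExpOf

/-! ### Exponentials in weighted `ℓ¹` algebras. -/

section Summability

open PowerSeries

lemma summable_hasSum_pow {R : Type*} [NormedCommRing R] [CompleteSpace R]
    {B : PowerSeries R} (h : Summable fun n => ‖coeff n B‖) (j : ℕ) :
    (Summable fun n => ‖coeff n (B ^ j)‖) ∧
      ∑' n, coeff n (B ^ j) = (∑' n, coeff n B) ^ j := by
  induction j with
  | zero =>
    have hz : ∀ n, n ≠ 0 → coeff n (B ^ 0) = 0 := fun n hn => by simp [coeff_one, hn]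
    refine ⟨summable_of_ne_finset_zero (s := {0}) fun n hn => ?_, ?_⟩
    · rw [hz n (by simpa using hn), norm_zero]
    · rw [tsum_eq_single 0 hz]; simp
  | succ j ih =>
    have e : ∀ n, coeff n (B ^ (j + 1)) =
        ∑ p ∈ Finset.HasAntidiagonal.antidiagonal n, coeff p.1 (B ^ j) * coeff p.2 B := fun n => by
      rw [pow_succ, coeff_mul]
    simp_rw [e]
    refine ⟨summable_norm_sum_mul_antidiagonal_of_summable_norm
      (f := fun n => coeff n (B ^ j)) (g := fun n => coeff n B) ih.1 h, ?_⟩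
    rw [← tsum_mul_tsum_eq_tsum_sum_antidiagonal_of_summable_norm
      (f := fun n => coeff n (B ^ j)) (g := fun n => coeff n B) ih.1 h, ih.2, pow_succ]

/-- Submultiplicativity lets the weight be distributed over the factors of a Cauchy product, so
powers of `B` are majorized by powers of the series of weighted norms. -/
lemma norm_coeff_pow_mul_le {B : PowerSeries ℂ} {w : ℕ → ℝ} (hw0 : ∀ n, 0 ≤ w n)
    (hw1 : w 0 ≤ 1) (hw : ∀ m n, w (m + n) ≤ w m * w n) (j n : ℕ) :
    w n * ‖coeff n (B ^ j)‖ ≤ coeff n ((mk fun n => w n * ‖coeff n B‖) ^ j) := by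
  induction j generalizing n with
  | zero =>
    rcases eq_or_ne n 0 with rfl | hn
    · simpa using hw1
    · simp [coeff_one, hn]
  | succ j ih =>
    rw [pow_succ, pow_succ, coeff_mul, coeff_mul]
    calc w n * ‖∑ p ∈ Finset.HasAntidiagonal.antidiagonal n, coeff p.1 (B ^ j) * coeff p.2 B‖
        ≤ w n * ∑ p ∈ Finset.HasAntidiagonal.antidiagonal n, ‖coeff p.1 (B ^ j)‖ * ‖coeff p.2 B‖ := by
          refine mul_le_mul_of_nonneg_left ((norm_sum_le _ _).trans ?_) (hw0 n)
          exact Finset.sum_le_sum fun p _ => norm_mul_le _ _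
      _ = ∑ p ∈ Finset.HasAntidiagonal.antidiagonal n, w n * (‖coeff p.1 (B ^ j)‖ * ‖coeff p.2 B‖) :=
          Finset.mul_sum _ _ _
      _ ≤ _ := by
          refine Finset.sum_le_sum fun p hp => ?_
          rw [Finset.HasAntidiagonal.mem_antidiagonal] at hp
          rw [coeff_mk]
          calc w n * (‖coeff p.1 (B ^ j)‖ * ‖coeff p.2 B‖)
              ≤ (w p.1 * w p.2) * (‖coeff p.1 (B ^ j)‖ * ‖coeff p.2 B‖) := by
                refine mul_le_mul_of_nonneg_right ?_ (by positivity)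
                rw [← hp]; exact hw _ _
            _ = (w p.1 * ‖coeff p.1 (B ^ j)‖) * (w p.2 * ‖coeff p.2 B‖) := by ring
            _ ≤ _ := mul_le_mul_of_nonneg_right (ih p.1)
                (mul_nonneg (hw0 _) (norm_nonneg _))

/-- The exponential of a power series that is absolutely summable for a submultiplicative weight. -/
lemma exp_subst_summable {B : PowerSeries ℂ} (hB : constantCoeff B = 0) {w : ℕ → ℝ}
    (hw0 : ∀ n, 1 ≤ w n) (hw1 : w 0 ≤ 1) (hw : ∀ m n, w (m + n) ≤ w m * w n)
    (hs : Summable fun n => w n * ‖coeff n B‖) :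
    (Summable fun n => w n * ‖coeff n ((exp ℂ).subst B)‖) ∧
      ∑' n, coeff n ((exp ℂ).subst B) = Complex.exp (∑' n, coeff n B) := by
  have hw0' : ∀ n, 0 ≤ w n := fun n => zero_le_one.trans (hw0 n)
  set A : PowerSeries ℝ := mk fun n => w n * ‖coeff n B‖ with hA
  have hA0 : ∀ n, 0 ≤ coeff n A := fun n => by
    rw [hA, coeff_mk]; exact mul_nonneg (hw0' n) (norm_nonneg _)
  have hAs : Summable fun n => ‖coeff n A‖ := by
    simpa [hA, abs_of_nonneg (hw0' _)] using hs
  have hBs : Summable fun n => ‖coeff n B‖ :=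
    hs.of_nonneg_of_le (fun _ => norm_nonneg _)
      fun n => le_mul_of_one_le_left (norm_nonneg _) (hw0 n)
  have hAj : ∀ j n, 0 ≤ coeff n (A ^ j) := fun j n =>
    (mul_nonneg (hw0' n) (norm_nonneg _)).trans (norm_coeff_pow_mul_le hw0' hw1 hw j n)
  -- The exponential is expanded as a double sum over the power and the degree. The majorant `K`
  -- absorbs the weight, and its total is the exponential series of the sum of `A`, which permits
  -- interchanging the two sums.
  let G : ℕ × ℕ → ℂ := fun p => (1 / (p.1.factorial : ℂ)) * coeff p.2 (B ^ p.1)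
  let K : ℕ × ℕ → ℝ := fun p => (1 / (p.1.factorial : ℝ)) * coeff p.2 (A ^ p.1)
  have hK0 : 0 ≤ K := fun p => mul_nonneg (by positivity) (hAj _ _)
  have hrow : ∀ j, Summable fun n => K (j, n) := fun j => by
    have := (summable_hasSum_pow hAs j).1
    simp_rw [Real.norm_eq_abs, abs_of_nonneg (hAj j _)] at this
    exact this.mul_left (1 / (j.factorial : ℝ))
  have hK : Summable K := by
    rw [summable_prod_of_nonneg hK0]
    refine ⟨hrow, ?_⟩
    have : (fun j => ∑' n, K (j, n)) = fun j => (∑' n, coeff n A) ^ j / j.factorial := by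
      ext j
      simp only [K]
      rw [tsum_mul_left, (summable_hasSum_pow hAs j).2]
      ring
    rw [this]
    exact Real.summable_pow_div_factorial _
  have hGK : ∀ p, w p.2 * ‖G p‖ ≤ K p := fun p => by
    have := norm_coeff_pow_mul_le (B := B) hw0' hw1 hw p.1 p.2
    simp only [G, K, norm_mul, norm_div, norm_one, Complex.norm_natCast]
    calc _ = 1 / (p.1.factorial : ℝ) * (w p.2 * ‖coeff p.2 (B ^ p.1)‖) := by ring
      _ ≤ _ := mul_le_mul_of_nonneg_left this (by positivity)
  have hGn : Summable fun p => ‖G p‖ := hK.of_nonneg_of_le (fun _ => norm_nonneg _) fun p =>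
    (le_mul_of_one_le_left (norm_nonneg _) (hw0 p.2)).trans (hGK p)
  have hG : Summable G := hGn.of_norm
  have hcol : ∀ n, Summable fun j => G (j, n) := fun n =>
    hG.comp_injective (i := fun j => (j, n)) fun a b h => (Prod.mk.inj h).1
  have hU : ∀ n, coeff n ((exp ℂ).subst B) = ∑' j, G (j, n) := fun n => by
    have hsub := HasSubst.of_constantCoeff_zero' hB
    -- Because `B` has no constant term, only finitely many powers contribute to a given degree, so
    -- the formal and the analytic sums agree.
    rw [coeff_subst' hsub, tsum_eq_finsum]
    · refine finsum_congr fun j => ?_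
      simp [G, coeff_exp]
    · convert! coeff_subst_finite' hsub (exp ℂ) n using 1
      ext j
      simp [G, coeff_exp]
  have hKcol : ∀ n, Summable fun j => K (j, n) := fun n =>
    hK.comp_injective (i := fun j => (j, n)) fun a b h => (Prod.mk.inj h).1
  constructor
  · refine Summable.of_nonneg_of_le (fun n => mul_nonneg (hw0' n) (norm_nonneg _)) (fun n => ?_)
      (f := fun n => ∑' j, K (j, n)) ?_
    · rw [hU]
      have h1 : Summable fun j => ‖G (j, n)‖ :=
        hGn.comp_injective (i := fun j => (j, n)) fun a b h => (Prod.mk.inj h).1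
      calc w n * ‖∑' j, G (j, n)‖ ≤ w n * ∑' j, ‖G (j, n)‖ :=
            mul_le_mul_of_nonneg_left (norm_tsum_le_tsum_norm h1) (hw0' n)
        _ = ∑' j, w n * ‖G (j, n)‖ := (tsum_mul_left).symm
        _ ≤ _ := (h1.mul_left _).tsum_le_tsum (fun j => hGK (j, n)) (hKcol n)
    · exact ((Equiv.prodComm ℕ ℕ).summable_iff.2 hK).prod
  · simp_rw [hU]
    rw [Complex.exp_eq_exp_ℂ, NormedSpace.exp_eq_tsum_div]
    rw [show (∑' n, ∑' j, G (j, n)) = ∑' j, ∑' n, G (j, n) from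
      hG.tsum_comm' (f := fun j n => G (j, n)) (fun j => hG.prod_factor j) hcol]
    refine tsum_congr fun j => ?_
    simp only [G]
    rw [tsum_mul_left, (summable_hasSum_pow hBs j).2]
    ring

end Summability

/-! ### Limits of convolutions. -/

section Convolution

/-- Consecutive ratios tending to one make all shifted ratios tend to one. -/
lemma tendsto_shift_div {v : ℕ → ℂ} (hv : ∀ n, v n ≠ 0)
    (h1 : Tendsto (fun n => v (n + 1) / v n) atTop (𝓝 1)) (k : ℕ) :
    Tendsto (fun n => v (n - k) / v n) atTop (𝓝 1) := by
  -- Shifting the index upwards avoids truncated subtraction in the induction.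
  have h : Tendsto (fun n => v n / v (n + k)) atTop (𝓝 1) := by
    induction k with
    | zero => simp [div_self (hv _)]
    | succ k ih =>
      have h2 := (h1.comp (tendsto_add_atTop_nat k)).inv₀ one_ne_zero
      have h3 := ih.mul h2
      simp only [inv_one, mul_one] at h3
      refine h3.congr fun n => ?_
      simp only [Function.comp_apply, inv_div]
      rw [div_mul_div_cancel₀ (hv _)]
      rfl
  rw [← tendsto_add_atTop_iff_nat k]
  simpa using h

/-- Tannery's theorem for convolutions. -/
lemma tendsto_convolution_div {u v : ℕ → ℂ} {g : ℕ → ℝ} (hv : ∀ n, v n ≠ 0)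
    (h1 : Tendsto (fun n => v (n + 1) / v n) atTop (𝓝 1))
    (hg : ∀ n k, k ≤ n → ‖v (n - k)‖ ≤ g k * ‖v n‖)
    (hs : Summable fun k => g k * ‖u k‖) :
    Tendsto (fun n => (∑ p ∈ Finset.HasAntidiagonal.antidiagonal n, u p.1 * v p.2) / v n) atTop
      (𝓝 (∑' k, u k)) := by
  have hg0 : ∀ k, 0 ≤ g k := fun k => by
    have := (norm_nonneg _).trans (hg k k le_rfl)
    exact nonneg_of_mul_nonneg_left this (norm_pos_iff.2 (hv k))
  let f : ℕ → ℕ → ℂ := fun n k => if k ≤ n then u k * (v (n - k) / v n) else 0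
  have hf : ∀ n, (∑ p ∈ Finset.HasAntidiagonal.antidiagonal n, u p.1 * v p.2) / v n =
      ∑' k, f n k := fun n => by
    rw [tsum_eq_sum (s := Finset.range (n + 1)), Finset.sum_div,
      Finset.Nat.sum_antidiagonal_eq_sum_range_succ_mk]
    · refine Finset.sum_congr rfl fun k hk => ?_
      simp only [f]
      rw [if_pos (by simpa [Nat.lt_succ_iff] using hk), mul_div_assoc]
    · intro k hk
      simp only [f]
      rw [if_neg (by simpa [Nat.lt_succ_iff] using hk)]
  simp_rw [hf]
  refine tendsto_tsum_of_dominated_convergence hs (fun k => ?_) (Eventually.of_forall fun n k => ?_)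
  · have := (tendsto_shift_div hv h1 k).const_mul (u k)
    rw [mul_one] at this
    refine this.congr' ?_
    filter_upwards [eventually_ge_atTop k] with n hn
    simp [f, hn]
  · simp only [f]
    split_ifs with hk
    · rw [norm_mul, norm_div, mul_comm]
      refine mul_le_mul_of_nonneg_right ?_ (norm_nonneg _)
      rw [div_le_iff₀ (norm_pos_iff.2 (hv n))]
      exact hg n k hk
    · simpa using mul_nonneg (hg0 k) (norm_nonneg _)

/-- Convolution of a null sequence with a sequence that is controlled by a nondecreasing one. -/
lemma tendsto_convolution_div_zero {β h : ℕ → ℂ} {T : ℕ → ℝ} {M : ℝ} (hT : ∀ n, 0 < T n)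
    (hmono : Monotone T) (hβ : Tendsto β atTop (𝓝 0))
    (hh : Tendsto (fun n => ‖h n‖ / T n) atTop (𝓝 0))
    (hM : ∀ n, ∑ j ∈ Finset.range (n + 1), ‖h j‖ ≤ M * T n) :
    Tendsto (fun n => (∑ p ∈ Finset.HasAntidiagonal.antidiagonal n, β p.1 * h p.2) / (T n : ℂ))
      atTop (𝓝 0) := by
  obtain ⟨Bd, hBd⟩ := (hβ.norm).bddAbove_range
  have hBd' : ∀ k, ‖β k‖ ≤ Bd := fun k => hBd ⟨k, rfl⟩
  have hBd0 : 0 ≤ Bd := (norm_nonneg _).trans (hBd' 0)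
  have hM0 : 0 ≤ M := by
    have := (Finset.sum_nonneg fun j _ => norm_nonneg (h j)).trans (hM 0)
    exact nonneg_of_mul_nonneg_left this (hT 0)
  rw [tendsto_zero_iff_norm_tendsto_zero, Metric.tendsto_atTop]
  intro ε hε
  -- The tail of `β` is made smaller than `δ`, which costs at most `δ M T n`; `M + 1` in the witness
  -- covers `M = 0`.
  obtain ⟨δ, hδ, hδM⟩ : ∃ δ > 0, δ * M < ε / 2 :=
    ⟨ε / (2 * (M + 1)), by positivity, by
      rw [div_mul_eq_mul_div, div_lt_div_iff₀ (by positivity) (by norm_num)]; nlinarith⟩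
  obtain ⟨K, hK⟩ := (Metric.tendsto_atTop.1 hβ) δ hδ
  have hfin : Tendsto (fun n => ∑ k ∈ Finset.range K, Bd * (‖h (n - k)‖ / T (n - k))) atTop
      (𝓝 0) := by
    rw [← Finset.sum_const_zero (s := Finset.range K)]
    refine tendsto_finsetSum _ fun k _ => ?_
    have := (hh.comp (tendsto_sub_atTop_nat k)).const_mul Bd
    simpa using this
  obtain ⟨n₀, hn₀⟩ := (Metric.tendsto_atTop.1 hfin) (ε / 2) (half_pos hε)
  refine ⟨max n₀ K, fun n hn => ?_⟩
  have h1 := hn₀ n (le_of_max_le_left hn)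
  have hKn : K ≤ n := le_of_max_le_right hn
  rw [Real.dist_0_eq_abs] at h1
  have h1' := lt_of_le_of_lt (le_abs_self _) h1
  rw [Real.dist_0_eq_abs, abs_of_nonneg (norm_nonneg _), norm_div, Complex.norm_real,
    Real.norm_of_nonneg (hT n).le, div_lt_iff₀ (hT n),
    Finset.Nat.sum_antidiagonal_eq_sum_range_succ_mk]
  -- For `k < K` the quotient `h (n - k) / T (n - k)` is small and `T (n - k) ≤ T n`; for the other
  -- `k`, `β k` is small.
  have key : ∀ k ∈ Finset.range (n + 1), ‖β k * h (n - k)‖ ≤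
      (if k < K then Bd * (‖h (n - k)‖ / T (n - k)) * T n else 0) + δ * ‖h (n - k)‖ := by
    intro k hk
    rw [norm_mul]
    split_ifs with hkK
    · have : ‖h (n - k)‖ ≤ ‖h (n - k)‖ / T (n - k) * T n := by
        rw [div_mul_eq_mul_div, le_div_iff₀ (hT _)]
        exact mul_le_mul_of_nonneg_left (hmono (Nat.sub_le n k)) (norm_nonneg _)
      have h2 : ‖β k‖ * ‖h (n - k)‖ ≤ Bd * (‖h (n - k)‖ / T (n - k) * T n) :=
        mul_le_mul (hBd' k) this (norm_nonneg _) hBd0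
      rw [mul_assoc]
      linarith [mul_nonneg hδ.le (norm_nonneg (h (n - k)))]
    · have := hK k (not_lt.1 hkK)
      rw [dist_zero_right] at this
      rw [zero_add]
      exact mul_le_mul_of_nonneg_right this.le (norm_nonneg _)
  refine lt_of_le_of_lt ((norm_sum_le _ _).trans (Finset.sum_le_sum key)) ?_
  rw [Finset.sum_add_distrib, ← Finset.sum_filter, ← Finset.mul_sum, ← Finset.sum_mul]
  have hfil : (Finset.range (n + 1)).filter (· < K) = Finset.range K := by
    ext k; simp only [Finset.mem_filter, Finset.mem_range]; omega
  rw [hfil]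
  have hrefl : ∑ k ∈ Finset.range (n + 1), ‖h (n - k)‖ = ∑ k ∈ Finset.range (n + 1), ‖h k‖ := by
    rw [← Finset.sum_range_reflect]
    exact Finset.sum_congr rfl fun k hk => by
      simp [Nat.sub_sub_self (Nat.lt_succ_iff.1 (Finset.mem_range.1 hk))]
  rw [hrefl]
  have h2 := mul_le_mul_of_nonneg_left (hM n) hδ.le
  have h3 := mul_lt_mul_of_pos_right h1' (hT n)
  have h4 := mul_lt_mul_of_pos_right hδM (hT n)
  nlinarith

end Convolution

/-! ### Growth of the coefficients of `(1 - t) ^ (-ϑ)`. -/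

/-- The coefficients of `(1 - t) ^ (-ϑ)`. -/
noncomputable def risingCoeff (ϑ : ℝ) (n : ℕ) : ℝ :=
  ∏ j ∈ Finset.range n, (ϑ + j) / (j + 1)

section RisingCoeff

variable {ϑ : ℝ}

lemma risingCoeff_zero : risingCoeff ϑ 0 = 1 := by simp [risingCoeff]

lemma risingCoeff_succ (n : ℕ) :
    risingCoeff ϑ (n + 1) = risingCoeff ϑ n * ((ϑ + n) / (n + 1)) := by
  rw [risingCoeff, Finset.prod_range_succ, risingCoeff]

lemma risingCoeff_pos (hϑ : 0 < ϑ) (n : ℕ) : 0 < risingCoeff ϑ n :=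
  Finset.prod_pos fun _ _ => by positivity

/-- Comparing coefficients in `t f' = ϑ (t / (1 - t)) f` for `f = (1 - t) ^ (-ϑ)` gives this
identity. It serves both as the exponential recurrence and as a closed form for the partial sums. -/
lemma sum_risingCoeff (n : ℕ) :
    ϑ * ∑ j ∈ Finset.range (n + 1), risingCoeff ϑ j = (n + 1) * risingCoeff ϑ (n + 1) := by
  induction n with
  | zero => simp [risingCoeff]
  | succ n ih =>
    have h : ((n : ℝ) + 1 + 1) ≠ 0 := by positivity
    rw [Finset.sum_range_succ, mul_add, ih, risingCoeff_succ (n + 1)]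
    push_cast
    field_simp
    ring

lemma isExpOf_risingCoeff :
    IsExpOf (PowerSeries.mk fun n => if n = 0 then 0 else (ϑ : ℂ))
      (PowerSeries.mk fun n => (risingCoeff ϑ n : ℂ)) := by
  refine IsExpOf.of_recurrence (by simp [risingCoeff_zero]) fun n => ?_
  rw [Finset.Nat.sum_antidiagonal_eq_sum_range_succ_mk]
  simp only [PowerSeries.coeff_mk]
  cases n with
  | zero => simp
  | succ n =>
    rw [Finset.sum_range_succ']
    simp only [Nat.add_eq_zero_iff, one_ne_zero, and_false, if_false, if_true, zero_mul, add_zero]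
    rw [← Finset.mul_sum]
    have := sum_risingCoeff (ϑ := ϑ) n
    rw [← Finset.sum_range_reflect] at this
    simp only [Nat.add_sub_cancel] at this
    have h2 : ∀ j ∈ Finset.range (n + 1), (risingCoeff ϑ (n + 1 - (j + 1)) : ℂ) =
        (risingCoeff ϑ (n - j) : ℂ) := fun j _ => by congr 2; omega
    rw [Finset.sum_congr rfl h2]
    exact_mod_cast this.symm

/-- The induction step is weighted AM-GM: `k^(1-ϑ) (k+1)^ϑ ≤ (1-ϑ) k + ϑ (k+1) = k + ϑ`. -/
lemma rpow_le_risingCoeff (hϑ : 0 < ϑ) (hϑ1 : ϑ ≤ 1) {k : ℕ} (hk : 1 ≤ k) :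
    ϑ * (k : ℝ) ^ (ϑ - 1) ≤ risingCoeff ϑ k := by
  induction k, hk using Nat.le_induction with
  | base => simp [risingCoeff]
  | succ k hk ih =>
    have hk0 : (0 : ℝ) < k := by exact_mod_cast hk
    have amgm := Real.geom_mean_le_arith_mean2_weighted (w₁ := 1 - ϑ) (w₂ := ϑ) (by linarith)
      hϑ.le hk0.le (by positivity : (0 : ℝ) ≤ (k : ℝ) + 1) (by ring)
    rw [risingCoeff_succ]
    push_cast
    refine le_trans ?_ (mul_le_mul_of_nonneg_right ih (by positivity))
    rw [mul_assoc]
    refine mul_le_mul_of_nonneg_left ?_ hϑ.le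
    rw [mul_div_assoc', le_div_iff₀ (by positivity)]
    have e1 : ((k : ℝ) + 1) ^ (ϑ - 1) * (k + 1) = ((k : ℝ) + 1) ^ ϑ := by
      rw [← Real.rpow_add_one (by positivity)]; congr 1; ring
    have e2 : (k : ℝ) ^ (ϑ - 1) * (k : ℝ) ^ (1 - ϑ) = 1 := by
      rw [← Real.rpow_add hk0]; simp
    rw [e1]
    calc ((k : ℝ) + 1) ^ ϑ = (k : ℝ) ^ (ϑ - 1) * ((k : ℝ) ^ (1 - ϑ) * ((k : ℝ) + 1) ^ ϑ) := by
          rw [← mul_assoc, e2, one_mul]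
      _ ≤ (k : ℝ) ^ (ϑ - 1) * (ϑ + k) := by
          refine mul_le_mul_of_nonneg_left (amgm.trans (le_of_eq (by ring))) (by positivity)

lemma risingCoeff_mono (hϑ : 1 ≤ ϑ) : Monotone (risingCoeff ϑ) :=
  monotone_nat_of_le_succ fun n => by
    rw [risingCoeff_succ]
    refine le_mul_of_one_le_right (risingCoeff_pos (by linarith) n).le ?_
    rw [one_le_div (by positivity)]
    linarith

/-- For `ϑ ≤ 1` the successive ratios `(ϑ + k) / (k + 1)` increase with `k`, which makes the
coefficients supermultiplicative. -/
lemma risingCoeff_mul_le (hϑ : 0 < ϑ) (hϑ1 : ϑ ≤ 1) (m k : ℕ) :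
    risingCoeff ϑ m * risingCoeff ϑ k ≤ risingCoeff ϑ (m + k) := by
  induction k with
  | zero => simp [risingCoeff_zero]
  | succ k ih =>
    rw [risingCoeff_succ, ← mul_assoc, ← add_assoc, risingCoeff_succ]
    refine mul_le_mul ih ?_ (by positivity) (risingCoeff_pos hϑ _).le
    rw [div_le_div_iff₀ (by positivity) (by positivity)]
    push_cast
    nlinarith [mul_nonneg (sub_nonneg.2 hϑ1) (Nat.cast_nonneg (α := ℝ) m)]

/-- This is the origin of the exponent `(1 - ϑ)_+`. For `ϑ ≥ 1` the coefficients are nondecreasing;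
for `ϑ ≤ 1`, supermultiplicativity is combined with the lower bound `ϑ (k + 1) ^ (ϑ - 1)`. -/
lemma risingCoeff_sub_le (hϑ : 0 < ϑ) : ∃ C : ℝ, ∀ n k : ℕ, k ≤ n →
    risingCoeff ϑ (n - k) ≤ C * ((k : ℝ) + 1) ^ max (1 - ϑ) 0 * risingCoeff ϑ n := by
  rcases le_total 1 ϑ with h | h
  · refine ⟨1, fun n k _ => ?_⟩
    rw [max_eq_right (by linarith), Real.rpow_zero, one_mul, one_mul]
    exact risingCoeff_mono h (Nat.sub_le n k)
  · refine ⟨ϑ⁻¹, fun n k hk => ?_⟩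
    rw [max_eq_left (by linarith)]
    have h1 := risingCoeff_mul_le hϑ h (n - k) k
    rw [Nat.sub_add_cancel hk] at h1
    have h2 : 1 ≤ ϑ⁻¹ * ((k : ℝ) + 1) ^ (1 - ϑ) * risingCoeff ϑ k := by
      have hkey : ϑ * ((k : ℝ) + 1) ^ (ϑ - 1) ≤ risingCoeff ϑ k := by
        rcases Nat.eq_zero_or_pos k with rfl | hk0
        · simpa [risingCoeff_zero] using h
        · refine le_trans ?_ (rpow_le_risingCoeff hϑ h hk0)
          refine mul_le_mul_of_nonneg_left ?_ hϑ.le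
          exact Real.rpow_le_rpow_of_nonpos (by exact_mod_cast hk0) (by linarith) (by linarith)
      calc (1 : ℝ) = ϑ⁻¹ * ((k : ℝ) + 1) ^ (1 - ϑ) * (ϑ * ((k : ℝ) + 1) ^ (ϑ - 1)) := by
            have e : ((k : ℝ) + 1) ^ (1 - ϑ) * ((k : ℝ) + 1) ^ (ϑ - 1) = 1 := by
              rw [← Real.rpow_add (by positivity)]; simp
            have : ϑ⁻¹ * ϑ = 1 := inv_mul_cancel₀ hϑ.ne'
            linear_combination -(ϑ⁻¹ * ϑ) * e - this
        _ ≤ _ := mul_le_mul_of_nonneg_left hkey (by positivity)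
    calc risingCoeff ϑ (n - k)
        ≤ risingCoeff ϑ (n - k) * (ϑ⁻¹ * ((k : ℝ) + 1) ^ (1 - ϑ) * risingCoeff ϑ k) :=
          le_mul_of_one_le_right (risingCoeff_pos hϑ _).le h2
      _ = ϑ⁻¹ * ((k : ℝ) + 1) ^ (1 - ϑ) * (risingCoeff ϑ (n - k) * risingCoeff ϑ k) := by ring
      _ ≤ _ := mul_le_mul_of_nonneg_left h1 (by positivity)

end RisingCoeff

/-! ### Asymptotics of the coefficients and of their ratios. -/

section Ratio

open PowerSeries

lemma coeff_mk_one_mul {R : Type*} [CommRing R] (U : PowerSeries R) (n : ℕ) :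
    coeff n ((mk fun _ => (1 : R)) * U) = ∑ j ∈ Finset.range (n + 1), coeff j U := by
  rw [coeff_mul, Finset.Nat.sum_antidiagonal_eq_sum_range_succ_mk, ← Finset.sum_range_reflect]
  refine Finset.sum_congr rfl fun k hk => ?_
  have := Finset.mem_range.1 hk
  simp only [coeff_mk, one_mul]
  congr 1
  congr 1
  omega

lemma sum_antidiagonal_ite {R : Type*} [CommRing R] (c : R) (u : ℕ → R) (n : ℕ) :
    ∑ p ∈ Finset.HasAntidiagonal.antidiagonal n, (if p.1 = 0 then 0 else c) * u p.2 =
      c * (∑ j ∈ Finset.range (n + 1), u j - u n) := by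
  have h : ∀ p ∈ Finset.HasAntidiagonal.antidiagonal n, (if p.1 = 0 then 0 else c) * u p.2 =
      c * u p.2 - (if p.1 = 0 then c * u n else 0) := by
    intro p hp
    rw [Finset.HasAntidiagonal.mem_antidiagonal] at hp
    split_ifs with h0
    · rw [show p.2 = n by omega]; ring
    · ring
  rw [Finset.sum_congr rfl h, Finset.sum_sub_distrib,
    Finset.Nat.sum_antidiagonal_eq_sum_range_succ_mk,
    Finset.Nat.sum_antidiagonal_eq_sum_range_succ_mk, mul_sub, Finset.mul_sum,
    ← Finset.sum_range_reflect (fun j => c * u j)]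
  simp

variable {ϑ : ℝ}

-- Applying Tannery directly to `H = (1 - t)^(-ϑ) exp(B)` would require `B` to be summable with the
-- weight `(k + 1)^((1-ϑ)_+)`, which `B_k = O(k^(-1-γ))` need not give. Instead Tannery is applied
-- to partial sums, whose comparison sequence `T` is monotone, so plain summability is enough. The
-- Euler recurrence then recovers single coefficients from partial sums, its error term being `o(T
-- n)` because `n B_n → 0`.
set_option maxHeartbeats 1000000 in
lemma tendsto_coeff_div_risingCoeff (hϑ : 0 < ϑ) {B H : PowerSeries ℂ}
    (hB : constantCoeff B = 0) (hs : Summable fun n => ‖coeff n B‖)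
    (h0 : Tendsto (fun n : ℕ => (n : ℂ) * coeff n B) atTop (𝓝 0))
    (hH : IsExpOf ((mk fun n => if n = 0 then 0 else (ϑ : ℂ)) + X * derivative ℂ B) H) :
    Tendsto (fun n => coeff n H / (risingCoeff ϑ n : ℂ)) atTop
      (𝓝 (Complex.exp (∑' n, coeff n B))) := by
  set e : PowerSeries ℂ := (exp ℂ).subst B with he
  set D : PowerSeries ℂ := mk fun n => (risingCoeff ϑ n : ℂ) with hD
  have hHe : H = D * e := hH.unique (isExpOf_risingCoeff.mul (IsExpOf.exp_subst hB))
  obtain ⟨hes, hesum⟩ := exp_subst_summable hB (w := fun _ => 1) (fun _ => le_rfl) le_rfl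
    (fun _ _ => by norm_num) (by simpa using hs)
  rw [← he] at hes hesum
  let T : ℕ → ℝ := fun n => ∑ j ∈ Finset.range (n + 1), risingCoeff ϑ j
  have hTpos : ∀ n, 0 < T n := fun n =>
    Finset.sum_pos (fun j _ => risingCoeff_pos hϑ j) ⟨0, by simp⟩
  have hTmono : Monotone T := monotone_nat_of_le_succ fun n => by
    simp only [T]
    rw [Finset.sum_range_succ _ (n + 1)]
    linarith [risingCoeff_pos hϑ (n + 1)]
  have hTne : ∀ n, (T n : ℂ) ≠ 0 := fun n => by exact_mod_cast (hTpos n).ne'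
  have hTD : ∀ n : ℕ, ϑ * T n = (n + 1) * risingCoeff ϑ (n + 1) := sum_risingCoeff
  have hTsucc : ∀ n, T (n + 1) = T n + risingCoeff ϑ (n + 1) := fun n => by
    simp only [T]; rw [Finset.sum_range_succ _ (n + 1)]
  have hDT : ∀ n : ℕ, risingCoeff ϑ (n + 1) = ϑ / (n + 1) * T n := fun n => by
    rw [div_mul_eq_mul_div, eq_div_iff (by positivity), hTD n]; ring
  have hsmall : Tendsto (fun n : ℕ => ϑ / ((n : ℝ) + 1)) atTop (𝓝 0) := by
    have := (tendsto_one_div_add_atTop_nhds_zero_nat (𝕜 := ℝ)).const_mul ϑ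
    simpa [div_eq_mul_inv] using this
  have hTratio : Tendsto (fun n => T (n + 1) / T n) atTop (𝓝 1) := by
    have : (fun n => T (n + 1) / T n) = fun n : ℕ => 1 + ϑ / ((n : ℝ) + 1) := by
      ext n
      rw [hTsucc, hDT, div_eq_iff (hTpos n).ne']; ring
    rw [this]
    simpa using hsmall.const_add 1
  have hTratioC : Tendsto (fun n => (T (n + 1) : ℂ) / T n) atTop (𝓝 1) := by
    have := (Complex.continuous_ofReal.tendsto _).comp hTratio
    simpa [Function.comp_def] using this
  -- the partial sums
  let S : ℕ → ℂ := fun n => ∑ j ∈ Finset.range (n + 1), coeff j H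
  have hS : ∀ n, S n = ∑ p ∈ Finset.HasAntidiagonal.antidiagonal n, coeff p.1 e * (T p.2 : ℂ) := by
    intro n
    simp only [S]
    rw [← coeff_mk_one_mul, hHe, ← mul_assoc, mul_comm, coeff_mul]
    refine Finset.sum_congr rfl fun p _ => ?_
    rw [coeff_mk_one_mul]
    simp [T, hD]
  have hSlim : Tendsto (fun n => S n / (T n : ℂ)) atTop (𝓝 (∑' n, coeff n e)) := by
    simp_rw [hS]
    refine tendsto_convolution_div (u := fun n => coeff n e) (v := fun n => (T n : ℂ))
      (g := fun _ => 1) hTne hTratioC (fun n k _ => ?_)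
      (by simpa using hes)
    rw [one_mul, Complex.norm_real, Complex.norm_real, Real.norm_of_nonneg (hTpos _).le,
      Real.norm_of_nonneg (hTpos _).le]
    exact hTmono (Nat.sub_le _ _)
  -- A coefficient is a difference of consecutive partial sums, and `S n / T n` converges while `T
  -- (n + 1) / T n` tends to `1`.
  have hHT : Tendsto (fun n => coeff n H / (T n : ℂ)) atTop (𝓝 0) := by
    rw [← tendsto_add_atTop_iff_nat 1]
    have h1 := (tendsto_add_atTop_iff_nat 1).2 hSlim
    have h2 := hSlim.mul (hTratioC.inv₀ one_ne_zero)
    have h3 := h1.sub h2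
    simp only [inv_one, mul_one, sub_self] at h3
    refine h3.congr fun n => ?_
    have : S (n + 1) = S n + coeff (n + 1) H := Finset.sum_range_succ _ _
    rw [this]
    have h4 := hTne n
    have h5 := hTne (n + 1)
    field_simp
    ring
  have hHabs : ∀ n, ∑ j ∈ Finset.range (n + 1), ‖coeff j H‖ ≤ (∑' k, ‖coeff k e‖) * T n := by
    intro n
    have hes' : Summable fun k => ‖coeff k e‖ := by simpa using hes
    calc ∑ j ∈ Finset.range (n + 1), ‖coeff j H‖
        ≤ ∑ j ∈ Finset.range (n + 1),
          coeff j ((mk fun k => ‖coeff k e‖) * (mk fun k => risingCoeff ϑ k)) := by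
          refine Finset.sum_le_sum fun j _ => ?_
          rw [hHe, mul_comm, coeff_mul, coeff_mul]
          refine (norm_sum_le _ _).trans (Finset.sum_le_sum fun p _ => ?_)
          simp [hD, abs_of_pos (risingCoeff_pos hϑ _)]
      _ = ∑ p ∈ Finset.HasAntidiagonal.antidiagonal n, ‖coeff p.1 e‖ * T p.2 := by
          rw [← coeff_mk_one_mul, mul_left_comm, coeff_mul]
          refine Finset.sum_congr rfl fun p _ => ?_
          rw [coeff_mk_one_mul]
          simp [T]
      _ ≤ ∑ p ∈ Finset.HasAntidiagonal.antidiagonal n, ‖coeff p.1 e‖ * T n := by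
          refine Finset.sum_le_sum fun p hp => mul_le_mul_of_nonneg_left (hTmono ?_) (norm_nonneg _)
          rw [Finset.HasAntidiagonal.mem_antidiagonal] at hp
          omega
      _ ≤ _ := by
          rw [← Finset.sum_mul, Finset.Nat.sum_antidiagonal_eq_sum_range_succ_mk]
          exact mul_le_mul_of_nonneg_right
            (hes'.sum_le_tsum _ fun _ _ => norm_nonneg _) (hTpos n).le
  have hconv := tendsto_convolution_div_zero (β := fun n : ℕ => (n : ℂ) * coeff n B)
    (h := fun n => coeff n H) hTpos hTmono h0 (by
      have := hHT.norm
      simp only [norm_zero, norm_div, Complex.norm_real] at this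
      exact this.congr fun n => by rw [Real.norm_of_nonneg (hTpos n).le]) hHabs
  -- The recurrence for `H`, split into the part of the exponent with constant coefficients `ϑ`,
  -- which yields partial sums, and the part from `B`, which yields a negligible convolution.
  have hrec : ∀ n : ℕ, (n : ℂ) * coeff n H / (T n : ℂ) =
      ϑ * (S n / (T n : ℂ) - coeff n H / (T n : ℂ)) +
        (∑ p ∈ Finset.HasAntidiagonal.antidiagonal n,
          ((p.1 : ℂ) * coeff p.1 B) * coeff p.2 H) / (T n : ℂ) := by
    intro n
    have h1 := hH.recurrence n
    simp only [map_add, coeff_mk, IsExpOf.coeff_euler, add_mul] at h1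
    rw [Finset.sum_add_distrib, sum_antidiagonal_ite (ϑ : ℂ) (fun n => coeff n H)] at h1
    rw [h1]
    simp only [S]
    ring
  have hnum : Tendsto (fun n : ℕ => (n : ℂ) * coeff n H / (T n : ℂ)) atTop
      (𝓝 (ϑ * ∑' n, coeff n e)) := by
    simp_rw [hrec]
    simpa using ((hSlim.sub hHT).const_mul (ϑ : ℂ)).add hconv
  have hden : Tendsto (fun n : ℕ => (n : ℂ) * (risingCoeff ϑ n : ℂ) / (T n : ℂ)) atTop
      (𝓝 (ϑ : ℂ)) := by
    rw [← tendsto_add_atTop_iff_nat 1]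
    have := (hTratioC.inv₀ one_ne_zero).const_mul (ϑ : ℂ)
    rw [inv_one, mul_one] at this
    refine this.congr fun n => ?_
    have h1 := congrArg (fun x : ℝ => (x : ℂ)) (hTD n)
    push_cast at h1
    rw [inv_div, mul_div_assoc', h1]
    push_cast
    rfl
  have hϑ' : (ϑ : ℂ) ≠ 0 := by exact_mod_cast hϑ.ne'
  have hfin := hnum.div hden hϑ'
  rw [mul_div_cancel_left₀ _ hϑ', hesum] at hfin
  refine hfin.congr' ?_
  filter_upwards [eventually_gt_atTop 0] with n hn
  have h1 : (n : ℂ) ≠ 0 := by exact_mod_cast hn.ne'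
  have h2 : (risingCoeff ϑ n : ℂ) ≠ 0 := by exact_mod_cast (risingCoeff_pos hϑ n).ne'
  have h3 := hTne n
  simp only [Pi.div_apply]
  field_simp

/-- Ratio asymptotics for the coefficients of two exponentials whose exponents differ by a
series that is summable with the weight `(k + 1) ^ max (1 - ϑ) 0`. -/
theorem tendsto_coeff_div_coeff (hϑ : 0 < ϑ) {A B C H H' : PowerSeries ℂ}
    (hB : constantCoeff B = 0) (hC : constantCoeff C = 0)
    (hBs : Summable fun n => ‖coeff n B‖)
    (hB0 : Tendsto (fun n : ℕ => (n : ℂ) * coeff n B) atTop (𝓝 0))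
    (hCs : Summable fun n : ℕ => ((n : ℝ) + 1) ^ max (1 - ϑ) 0 * ‖coeff n C‖)
    (hA : A = (mk fun n => if n = 0 then 0 else (ϑ : ℂ)) + X * derivative ℂ B)
    (hH : IsExpOf A H) (hH' : IsExpOf (A + X * derivative ℂ C) H')
    (hne : ∀ n, coeff n H ≠ 0) :
    Tendsto (fun n => coeff n H' / coeff n H) atTop (𝓝 (Complex.exp (∑' n, coeff n C))) := by
  set p := max (1 - ϑ) 0 with hp
  have hp0 : 0 ≤ p := le_max_right _ _
  obtain ⟨hys, hysum⟩ := exp_subst_summable hC (w := fun n => ((n : ℝ) + 1) ^ p)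
    (fun n => Real.one_le_rpow (by linarith [Nat.cast_nonneg (α := ℝ) n]) hp0) (by simp)
    -- Submultiplicativity of the weight comes from `m + n + 1 ≤ (m + 1)(n + 1)`.
    (fun m n => by
      rw [← Real.mul_rpow (by positivity) (by positivity)]
      refine Real.rpow_le_rpow (by positivity) ?_ hp0
      push_cast
      nlinarith [Nat.cast_nonneg (α := ℝ) n, Nat.cast_nonneg (α := ℝ) m,
        mul_nonneg (Nat.cast_nonneg (α := ℝ) n) (Nat.cast_nonneg (α := ℝ) m)]) hCs
  have hprod : H' = (exp ℂ).subst C * H := by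
    rw [mul_comm]; exact hH'.unique (hH.mul (IsExpOf.exp_subst hC))
  have hlim := tendsto_coeff_div_risingCoeff hϑ hB hBs hB0 (hA ▸ hH)
  have hDpos := risingCoeff_pos hϑ
  have hDne : ∀ n, (risingCoeff ϑ n : ℂ) ≠ 0 := fun n => by exact_mod_cast (hDpos n).ne'
  -- two-sided comparison
  obtain ⟨M, hM⟩ := hlim.norm.bddAbove_range
  obtain ⟨M', hM'⟩ := (hlim.inv₀ (Complex.exp_ne_zero _)).norm.bddAbove_range
  have hM1 : ∀ n, ‖coeff n H‖ ≤ M * risingCoeff ϑ n := fun n => by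
    have := hM ⟨n, rfl⟩
    simp only [norm_div, Complex.norm_real, Real.norm_of_nonneg (hDpos n).le] at this
    rwa [div_le_iff₀ (hDpos n)] at this
  have hM2 : ∀ n, risingCoeff ϑ n ≤ M' * ‖coeff n H‖ := fun n => by
    have := hM' ⟨n, rfl⟩
    simp only [inv_div, norm_div, Complex.norm_real, Real.norm_of_nonneg (hDpos n).le] at this
    rwa [div_le_iff₀ (norm_pos_iff.2 (hne n))] at this
  have hM0 : 0 ≤ M := (norm_nonneg _).trans (hM ⟨0, rfl⟩)
  obtain ⟨K, hK⟩ := risingCoeff_sub_le hϑ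
  have hK0 : 0 ≤ K := by
    have := hK 0 0 le_rfl
    simp only [Nat.sub_zero, CharP.cast_eq_zero, zero_add, Real.one_rpow, mul_one] at this
    exact nonneg_of_mul_nonneg_left ((hDpos 0).le.trans this) (hDpos 0)
  have hDratio : Tendsto (fun n : ℕ => (risingCoeff ϑ (n + 1) : ℂ) / risingCoeff ϑ n) atTop
      (𝓝 1) := by
    have h1 : Tendsto (fun n : ℕ => risingCoeff ϑ (n + 1) / risingCoeff ϑ n) atTop (𝓝 1) := by
      have : (fun n : ℕ => risingCoeff ϑ (n + 1) / risingCoeff ϑ n) =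
          fun n : ℕ => 1 + (ϑ - 1) * (1 / ((n : ℝ) + 1)) := by
        ext n
        rw [risingCoeff_succ, mul_div_cancel_left₀ _ (hDpos n).ne']
        field_simp
        ring
      rw [this]
      simpa using ((tendsto_one_div_add_atTop_nhds_zero_nat (𝕜 := ℝ)).const_mul
        (ϑ - 1)).const_add 1
    have := (Complex.continuous_ofReal.tendsto _).comp h1
    simpa [Function.comp_def] using this
  have hHratio : Tendsto (fun n => coeff (n + 1) H / coeff n H) atTop (𝓝 1) := by
    have h1 := ((tendsto_add_atTop_iff_nat 1).2 hlim).div hlim (Complex.exp_ne_zero _)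
    have h2 := h1.mul hDratio
    rw [div_self (Complex.exp_ne_zero _), one_mul] at h2
    refine h2.congr fun n => ?_
    have h3 := hDne n
    have h4 := hDne (n + 1)
    have h5 := hne n
    simp only [Pi.div_apply]
    field_simp
  -- The constant `M * K * M'` arises by passing from `H` to the model coefficients, shifting there,
  -- and passing back.
  have hfinal := tendsto_convolution_div (u := fun n => coeff n ((exp ℂ).subst C))
    (v := fun n => coeff n H) (g := fun k => M * K * M' * ((k : ℝ) + 1) ^ p) hne hHratio
    (fun n k hk => by
      calc ‖coeff (n - k) H‖ ≤ M * risingCoeff ϑ (n - k) := hM1 _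
        _ ≤ M * (K * ((k : ℝ) + 1) ^ p * (M' * ‖coeff n H‖)) := by
          refine mul_le_mul_of_nonneg_left ((hK n k hk).trans ?_) hM0
          exact mul_le_mul_of_nonneg_left (hM2 n) (by positivity)
        _ = _ := by ring)
    (by simpa [mul_assoc] using hys.mul_left (M * K * M'))
  rw [hysum] at hfinal
  refine hfinal.congr fun n => ?_
  rw [hprod, coeff_mul]

end Ratio

/-! ### The exponential formula for symmetric groups. -/

section Permutations

/-- The product of the factorials of the multiplicities. -/
def multFactorial (m : Multiset ℕ) : ℕ := ∏ k ∈ m.toFinset, (m.count k).factorial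

lemma multFactorial_eq_prod {m : Multiset ℕ} {s : Finset ℕ} (hs : m.toFinset ⊆ s) :
    multFactorial m = ∏ k ∈ s, (m.count k).factorial := by
  refine Finset.prod_subset hs fun k _ hk => ?_
  rw [Multiset.mem_toFinset] at hk
  rw [Multiset.count_eq_zero_of_notMem hk, Nat.factorial_zero]

lemma multFactorial_pos (m : Multiset ℕ) : 0 < multFactorial m :=
  Finset.prod_pos fun _ _ => Nat.factorial_pos _

lemma multFactorial_cons (k : ℕ) (m : Multiset ℕ) :
    multFactorial (k ::ₘ m) = (m.count k + 1) * multFactorial m := by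
  rw [multFactorial_eq_prod (m := m) (s := insert k m.toFinset) (Finset.subset_insert _ _),
    multFactorial, Multiset.toFinset_cons,
    ← Finset.mul_prod_erase _ _ (Finset.mem_insert_self k m.toFinset),
    ← Finset.mul_prod_erase _ _ (Finset.mem_insert_self k m.toFinset),
    Multiset.count_cons_self, Nat.factorial_succ, mul_assoc]
  congr 2
  refine Finset.prod_congr rfl fun j hj => ?_
  rw [Multiset.count_cons_of_ne (Finset.ne_of_mem_erase hj)]

lemma multFactorial_add_replicate {m : Multiset ℕ} {k : ℕ} (hk : k ∉ m) (c : ℕ) :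
    multFactorial (m + Multiset.replicate c k) = c.factorial * multFactorial m := by
  induction c with
  | zero => simp
  | succ c ih =>
    rw [Multiset.replicate_succ, Multiset.add_cons, multFactorial_cons, ih, Multiset.count_add,
      Multiset.count_eq_zero_of_notMem hk, Multiset.count_replicate_self, zero_add,
      Nat.factorial_succ, mul_assoc]

/-- The number of permutations with given cycle lengths. -/
lemma card_partition_eq {α : Type*} [Fintype α] [DecidableEq α]
    (p : (Fintype.card α).Partition) :
    (Finset.univ.filter fun σ : Equiv.Perm α => σ.partition = p).card *
      (p.parts.prod * multFactorial p.parts) = (Fintype.card α).factorial := by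
  -- Cycle types omit fixed points whereas partitions record them as parts `1`; `m` collects the
  -- parts that belong to the cycle type.
  set m := p.parts.filter fun k => 2 ≤ k with hm
  have hone : ∀ k ∈ p.parts, ¬ 2 ≤ k → k = 1 := fun k hk h => by
    have := p.parts_pos hk; omega
  have hparts : p.parts = m + Multiset.replicate (p.parts.filter fun k => ¬ 2 ≤ k).card 1 := by
    conv_lhs => rw [← Multiset.filter_add_not (fun k => 2 ≤ k) p.parts]
    rw [← hm]
    congr 1
    rw [Multiset.eq_replicate]
    refine ⟨rfl, fun k hk => ?_⟩
    rw [Multiset.mem_filter] at hk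
    exact hone k hk.1 hk.2
  set c := (p.parts.filter fun k => ¬ 2 ≤ k).card
  have hsum : m.sum + c = Fintype.card α := by
    rw [← p.parts_sum, hparts]
    simp
  have h1m : 1 ∉ m := fun h => by
    rw [hm, Multiset.mem_filter] at h; omega
  have hfil : (Finset.univ.filter fun σ : Equiv.Perm α => σ.partition = p) =
      Finset.univ.filter fun σ : Equiv.Perm α => σ.cycleType = m := by
    ext σ
    simp only [Finset.mem_filter, Finset.mem_univ, true_and]
    constructor
    · intro h
      rw [hm, ← h, Equiv.Perm.filter_parts_partition_eq_cycleType]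
    · intro h
      rw [Nat.Partition.ext_iff, Equiv.Perm.parts_partition, hparts, h, ← Equiv.Perm.sum_cycleType,
        h]
      congr 2
      omega
  have key := Equiv.Perm.card_of_cycleType_mul_eq α m
  rw [if_pos ⟨by omega, fun a ha => (Multiset.mem_filter.1 ha).2⟩] at key
  rw [hfil, ← key, hparts, multFactorial_add_replicate h1m]
  have hc : Fintype.card α - m.sum = c := by omega
  rw [hc]
  simp [multFactorial]
  left
  ring

/-- The contribution of the permutations with given cycle lengths. -/
noncomputable def partWeight (x : ℕ → ℂ) (m : Multiset ℕ) : ℂ :=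
  (m.map fun k => x k / k).prod / multFactorial m

/-- The average over the symmetric group of `∏_k x_k ^ C_k`. -/
noncomputable def permAverage (x : ℕ → ℂ) (n : ℕ) : ℂ :=
  (1 / (n.factorial : ℂ)) * ∑ σ : Equiv.Perm (Fin n), (σ.partition.parts.map x).prod

lemma sum_perm_eq_sum_partition (x : ℕ → ℂ) (α : Type*) [Fintype α] [DecidableEq α] {n : ℕ}
    (hn : Fintype.card α = n) :
    (1 / (n.factorial : ℂ)) * ∑ σ : Equiv.Perm α, (σ.partition.parts.map x).prod =
    ∑ p : n.Partition, partWeight x p.parts := by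
  subst hn
  rw [← Finset.sum_fiberwise (s := Finset.univ) (g := fun σ : Equiv.Perm α => σ.partition),
    Finset.mul_sum]
  refine Finset.sum_congr rfl fun p _ => ?_
  have h1 : ∑ σ : Equiv.Perm α with σ.partition = p, (σ.partition.parts.map x).prod =
      ((Finset.univ.filter fun σ : Equiv.Perm α => σ.partition = p).card : ℂ) *
        (p.parts.map x).prod := by
    rw [← nsmul_eq_mul, ← Finset.sum_const]
    refine Finset.sum_congr rfl fun σ hσ => ?_
    rw [(Finset.mem_filter.1 hσ).2]
  have h2 := congrArg (fun n : ℕ => (n : ℂ)) (card_partition_eq p)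
  push_cast at h2
  have h3 : (p.parts.map fun k => x k / k).prod =
      (p.parts.map x).prod / (p.parts.map fun k : ℕ => (k : ℂ)).prod :=
    Multiset.prod_map_div
  have h4 : (p.parts.map fun k : ℕ => (k : ℂ)).prod ≠ 0 := by
    refine Multiset.prod_ne_zero fun h => ?_
    obtain ⟨k, hk, hk0⟩ := Multiset.mem_map.1 h
    exact (p.parts_pos hk).ne' (by exact_mod_cast hk0)
  have h5 : (multFactorial p.parts : ℂ) ≠ 0 := by exact_mod_cast (multFactorial_pos _).ne'
  have h6 : ((Fintype.card α).factorial : ℂ) ≠ 0 := by exact_mod_cast Nat.factorial_ne_zero _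
  rw [h1, partWeight, h3, div_div, eq_div_iff (mul_ne_zero h4 h5), div_mul_eq_mul_div, one_mul,
    div_mul_eq_mul_div, div_eq_iff h6, ← h2]
  ring

lemma permAverage_eq_sum_partition (x : ℕ → ℂ) (n : ℕ) :
    permAverage x n = ∑ p : n.Partition, partWeight x p.parts :=
  sum_perm_eq_sum_partition x (Fin n) (Fintype.card_fin n)

lemma count_mul_partWeight_cons (x : ℕ → ℂ) {k : ℕ} (hk : k ≠ 0) (m : Multiset ℕ) :
    (((k ::ₘ m).count k * k : ℕ) : ℂ) * partWeight x (k ::ₘ m) = x k * partWeight x m := by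
  have h5 : (multFactorial m : ℂ) ≠ 0 := by exact_mod_cast (multFactorial_pos _).ne'
  have h6 : (k : ℂ) ≠ 0 := by exact_mod_cast hk
  have h7 : (m.count k : ℂ) + 1 ≠ 0 := by exact_mod_cast Nat.succ_ne_zero (m.count k)
  rw [partWeight, partWeight, multFactorial_cons, Multiset.count_cons_self, Multiset.map_cons,
    Multiset.prod_cons]
  push_cast
  field_simp

/-- Removing one part `k` is a bijection from the partitions of `n` that contain `k` to the
partitions of `n - k`; the factor `count k * k` compensates the change of weight, and it kills the
partitions without `k`. -/
lemma sum_partition_count_mul (x : ℕ → ℂ) {n k : ℕ} (hk : k ≠ 0) (hkn : k ≤ n) :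
    ∑ p : n.Partition, ((p.parts.count k * k : ℕ) : ℂ) * partWeight x p.parts =
      x k * permAverage x (n - k) := by
  rw [permAverage_eq_sum_partition, Finset.mul_sum]
  symm
  let e : (n - k).Partition → n.Partition := fun q =>
    { parts := k ::ₘ q.parts
      parts_pos := fun {i} hi => by
        rcases Multiset.mem_cons.1 hi with rfl | h
        · omega
        · exact q.parts_pos h
      parts_sum := by rw [Multiset.sum_cons, q.parts_sum]; omega }
  refine Finset.sum_of_injOn e ?_ (fun _ _ => by simp) ?_ ?_
  · intro q _ q' _ h
    have := congrArg Nat.Partition.parts h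
    exact Nat.Partition.ext ((Multiset.cons_inj_right k).1 this)
  · intro p _ hp
    have : p.parts.count k = 0 := by
      rw [Multiset.count_eq_zero]
      intro hmem
      refine hp ⟨⟨p.parts.erase k, fun {i} hi => p.parts_pos (Multiset.mem_of_mem_erase hi), ?_⟩,
        by simp, ?_⟩
      · have h1 := p.parts_sum
        rw [← Multiset.cons_erase hmem, Multiset.sum_cons] at h1
        omega
      · exact Nat.Partition.ext (Multiset.cons_erase hmem)
    simp [this]
  · intro q _
    exact (count_mul_partWeight_cons x hk q.parts).symm

/-- The exponential formula for the symmetric groups. -/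
theorem isExpOf_permAverage (x : ℕ → ℂ) :
    IsExpOf (PowerSeries.mk fun n => if n = 0 then 0 else x n)
      (PowerSeries.mk (permAverage x)) := by
  refine IsExpOf.of_recurrence (by simp [permAverage, Finset.univ_unique,
    Equiv.Perm.parts_partition]) fun n => ?_
  simp only [PowerSeries.coeff_mk]
  rw [permAverage_eq_sum_partition, Finset.mul_sum]
  -- Writing `n` as the sum of the parts turns `n` times the average into a sum over the size of a
  -- removed part.
  have hn : ∀ p : n.Partition, (n : ℂ) = ∑ k ∈ Finset.Icc 1 n, ((p.parts.count k * k : ℕ) : ℂ) := by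
    intro p
    rw [← Nat.cast_sum]
    congr 1
    conv_lhs => rw [← p.parts_sum]
    rw [Finset.sum_multiset_count_of_subset p.parts (Finset.Icc 1 n)]
    · simp
    · intro k hk
      rw [Multiset.mem_toFinset] at hk
      rw [Finset.mem_Icc]
      exact ⟨p.parts_pos hk, p.parts_sum ▸ Multiset.le_sum_of_mem hk⟩
  have h1 : ∀ p : n.Partition, (n : ℂ) * partWeight x p.parts =
      ∑ k ∈ Finset.Icc 1 n, ((p.parts.count k * k : ℕ) : ℂ) * partWeight x p.parts := fun p => by
    rw [← Finset.sum_mul, ← hn p]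
  rw [Finset.sum_congr rfl fun p _ => h1 p, Finset.sum_comm,
    Finset.Nat.sum_antidiagonal_eq_sum_range_succ_mk]
  refine Finset.sum_subset_zero_on_sdiff (fun k hk => ?_) (fun k hk => ?_) fun k hk => ?_
  · rw [Finset.mem_Icc] at hk; simp; omega
  · have : k = 0 := by
      simp only [Finset.mem_sdiff, Finset.mem_range, Finset.mem_Icc] at hk; omega
    simp [this]
  · rw [Finset.mem_Icc] at hk
    have h0 : k ≠ 0 := by omega
    simp only [h0, if_false]
    exact sum_partition_count_mul x h0 hk.2

/-- The cycle lengths add up to `n`, so the rescaling of the variable factors out and disappears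
from quotients. -/
lemma permAverage_mul_pow (x : ℕ → ℂ) (r : ℂ) (n : ℕ) :
    permAverage (fun k => x k * r ^ k) n = r ^ n * permAverage x n := by
  have h : ∀ m : Multiset ℕ, (m.map fun k => r ^ k).prod = r ^ m.sum := fun m => by
    induction m using Multiset.induction_on with
    | empty => simp
    | cons a s ih => simp [ih, pow_add]
  simp only [permAverage, Multiset.prod_map_mul, h, Nat.Partition.parts_sum, Fintype.card_fin]
  rw [← Finset.sum_mul]
  ring

end Permutations

/-! ### The characteristic polynomial of one weighted cycle. -/

section CyclicMatrix

open Polynomial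

/-- A permutation that agrees at each point with the identity or with a transitive
permutation `τ` is the identity or `τ`. -/
lemma eq_one_or_eq_of_forall_apply {α : Type*} [Finite α] {τ π : Equiv.Perm α}
    (hτ : ∀ i j, τ.SameCycle i j) (h : ∀ i, π i = i ∨ π i = τ i) : π = 1 ∨ π = τ := by
  by_cases hex : ∃ i, π i = i
  · left
    obtain ⟨i, hi⟩ := hex
    have step : ∀ j, π j = j → π (τ.symm j) = τ.symm j := by
      intro j hj
      rcases h (τ.symm j) with h1 | h1
      · exact h1
      · rw [Equiv.apply_symm_apply] at h1
        have : τ.symm j = j := π.injective (h1.trans hj.symm)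
        rw [this, hj]
    ext j
    obtain ⟨n, rfl⟩ := (Equiv.Perm.sameCycle_inv.2 (hτ i j)).exists_nat_pow_eq
    rw [Equiv.Perm.one_apply]
    induction n with
    | zero => simpa using hi
    | succ n ih => rw [pow_succ', Equiv.Perm.mul_apply]; exact step _ ih
  · right
    push Not at hex
    ext i
    exact (h i).resolve_left (hex i)

/-- The characteristic matrix vanishes off the positions `(j, j)` and `(τ j, j)`. By transitivity of
`τ`, only the identity and `τ` survive in the Leibniz expansion. -/
lemma charpoly_cyclic {α : Type*} [Fintype α] [DecidableEq α] [Nonempty α] (τ : Equiv.Perm α)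
    (hτ : ∀ i j, τ.SameCycle i j) (z : α → ℂ) :
    (Matrix.of fun i j => if i = τ j then z i else 0).charpoly =
      X ^ Fintype.card α - C (∏ i, z i) := by
  -- On a single point the identity and `τ` coincide, and the two terms of the expansion merge.
  rcases subsingleton_or_nontrivial α with hα | hα
  · obtain ⟨a⟩ := ‹Nonempty α›
    let _ : Unique α := ⟨⟨a⟩, fun b => Subsingleton.elim _ _⟩
    rw [Matrix.charpoly, Matrix.det_unique, Matrix.charmatrix_apply]
    simp [Subsingleton.elim (τ default) default]
  · have hne : ∀ i, τ i ≠ i := by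
      intro i hi
      obtain ⟨j, hj⟩ := exists_ne i
      have := hτ i j
      exact hj (this.eq_of_left hi).symm
    have h1τ : (1 : Equiv.Perm α) ≠ τ := by
      rintro rfl
      obtain ⟨a⟩ := ‹Nonempty α›
      exact hne a rfl
    have hcyc : τ.IsCycle := by
      obtain ⟨a⟩ := ‹Nonempty α›
      exact ⟨a, hne a, fun y _ => hτ a y⟩
    have hsupp : τ.support = Finset.univ := by
      ext i; simp [hne i]
    have entry : ∀ i j, (Matrix.of fun i j => if i = τ j then z i else 0).charmatrix i j =
        (if i = j then X else 0) - C (if i = τ j then z i else 0) := by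
      intro i j
      rw [Matrix.charmatrix_apply, Matrix.diagonal_apply, Matrix.of_apply]
    rw [Matrix.charpoly, Matrix.det_apply']
    rw [← Finset.sum_subset (Finset.subset_univ {1, τ})]
    · rw [Finset.sum_pair h1τ]
      have e1 : ∏ i, (Matrix.of fun i j => if i = τ j then z i else 0).charmatrix
          ((1 : Equiv.Perm α) i) i = X ^ Fintype.card α := by
        rw [← Finset.card_univ, ← Finset.prod_const]
        refine Finset.prod_congr rfl fun i _ => ?_
        rw [entry]
        simp [(hne i).symm]
      have e2 : ∏ i, (Matrix.of fun i j => if i = τ j then z i else 0).charmatrix (τ i) i =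
          (-1) ^ Fintype.card α * C (∏ i, z i) := by
        rw [← Finset.card_univ, ← Finset.prod_const, map_prod,
          ← Equiv.prod_comp τ (fun i => C (z i)), ← Finset.prod_mul_distrib]
        refine Finset.prod_congr rfl fun i _ => ?_
        rw [entry]
        simp [hne i]
      rw [e1, e2, Equiv.Perm.sign_one, hcyc.sign, hsupp, Finset.card_univ]
      -- The sign `-(-1)^n` of the cycle meets the sign `(-1)^n` of the product of the entries `-z
      -- i`.
      have : ((-1 : ℂ[X]) ^ Fintype.card α) * (-1) ^ Fintype.card α = 1 := by
        rw [← mul_pow]; simp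
      push_cast
      linear_combination -C (∏ i, z i) * this
    · intro π _ hπ
      have hπ' : ∃ i, ¬ (π i = i ∨ π i = τ i) := by
        by_contra hcon
        push Not at hcon
        exact hπ (by simpa using eq_one_or_eq_of_forall_apply hτ hcon)
      obtain ⟨i, hi⟩ := hπ'
      push Not at hi
      rw [Finset.prod_eq_zero (Finset.mem_univ i), mul_zero]
      rw [entry]
      simp [hi.1, hi.2]

end CyclicMatrix

/-! ### Decomposition of the trace over the cycles. -/

section Blocks

variable {N : ℕ} (σ : Equiv.Perm (Fin N))

/-- A representative of the cycle that contains a given point. -/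
noncomputable def cycleRep (i : Fin N) : Fin N :=
  (Quotient.mk (Equiv.Perm.SameCycle.setoid σ) i).out

/-- The representatives of the cycles. -/
noncomputable def cycleReps : Finset (Fin N) := Finset.univ.image (cycleRep σ)

/-- The points with a given cycle representative. -/
noncomputable def cycleBlock (a : Fin N) : Finset (Fin N) :=
  Finset.univ.filter fun i => cycleRep σ i = a

variable {σ}

lemma cycleRep_eq_iff {i j : Fin N} : cycleRep σ i = cycleRep σ j ↔ σ.SameCycle i j := by
  rw [cycleRep, cycleRep, Quotient.out_inj, Quotient.eq]
  rfl

lemma cycleRep_cycleRep (i : Fin N) : cycleRep σ (cycleRep σ i) = cycleRep σ i := by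
  rw [cycleRep, cycleRep, Quotient.out_eq]

lemma cycleRep_of_mem {a : Fin N} (ha : a ∈ cycleReps σ) : cycleRep σ a = a := by
  obtain ⟨i, _, rfl⟩ := Finset.mem_image.1 ha
  exact cycleRep_cycleRep i

lemma mem_cycleBlock {a i : Fin N} : i ∈ cycleBlock σ a ↔ cycleRep σ i = a := by
  simp [cycleBlock]

lemma mem_cycleBlock_iff_sameCycle {a i : Fin N} (ha : a ∈ cycleReps σ) :
    i ∈ cycleBlock σ a ↔ σ.SameCycle a i := by
  rw [mem_cycleBlock, ← cycleRep_eq_iff, cycleRep_of_mem ha, eq_comm]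

lemma card_cycleBlock_pos {a : Fin N} (ha : a ∈ cycleReps σ) : 0 < (cycleBlock σ a).card :=
  Finset.card_pos.2 ⟨a, mem_cycleBlock.2 (cycleRep_of_mem ha)⟩

lemma cycleRep_eq_self_of_fixed {i : Fin N} (hi : σ i = i) : cycleRep σ i = i := by
  have h : σ.SameCycle i (cycleRep σ i) := cycleRep_eq_iff.1 (cycleRep_cycleRep i).symm
  exact (h.eq_of_left hi).symm

/-- The cycle lengths are the cardinalities of the blocks. -/
lemma parts_partition_eq_map_card :
    σ.partition.parts = (cycleReps σ).val.map fun a => (cycleBlock σ a).card := by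
  -- Nontrivial cycles correspond to `cycleType`, fixed points to the additional parts `1`.
  have hsplit : (cycleReps σ).val = ((cycleReps σ).filter fun a => σ a ≠ a).val +
      ((cycleReps σ).filter fun a => ¬ σ a ≠ a).val := by
    rw [Finset.filter_val, Finset.filter_val, Multiset.filter_add_not]
  rw [hsplit, Multiset.map_add, Equiv.Perm.parts_partition, Equiv.Perm.cycleType_def]
  congr 1
  · have hinj : Set.InjOn (fun a => σ.cycleOf a)
        ((cycleReps σ).filter fun a => σ a ≠ a : Finset (Fin N)) := by
      intro a ha b hb hab
      simp only [Finset.coe_filter, Set.mem_ofPred_eq] at ha hb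
      have hs : b ∈ (σ.cycleOf a).support := by
        have hab' : σ.cycleOf a = σ.cycleOf b := hab
        rw [hab', Equiv.Perm.mem_support_cycleOf_iff' hb.2]
      rw [Equiv.Perm.mem_support_cycleOf_iff' ha.2, ← cycleRep_eq_iff, cycleRep_of_mem ha.1,
        cycleRep_of_mem hb.1] at hs
      exact hs
    have himg : σ.cycleFactorsFinset =
        ((cycleReps σ).filter fun a => σ a ≠ a).image fun a => σ.cycleOf a := by
      ext c
      rw [Finset.mem_image]
      constructor
      · intro hc
        obtain ⟨hcyc, -⟩ := Equiv.Perm.mem_cycleFactorsFinset_iff.1 hc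
        obtain ⟨x, hx⟩ := hcyc.nonempty_support
        have hcx := Equiv.Perm.cycle_is_cycleOf hx hc
        have hsc : σ.SameCycle (cycleRep σ x) x := cycleRep_eq_iff.1 (cycleRep_cycleRep x)
        refine ⟨cycleRep σ x, ?_, ?_⟩
        · rw [Finset.mem_filter]
          refine ⟨Finset.mem_image_of_mem _ (Finset.mem_univ x), fun hfix => ?_⟩
          have := hsc.eq_of_left hfix
          rw [this] at hfix
          exact Equiv.Perm.mem_support.1
            (Equiv.Perm.mem_cycleFactorsFinset_support_le hc hx) hfix
        · rw [hcx]; exact hsc.cycleOf_eq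
      · rintro ⟨a, ha, rfl⟩
        rw [Equiv.Perm.cycleOf_mem_cycleFactorsFinset_iff, Equiv.Perm.mem_support]
        exact (Finset.mem_filter.1 ha).2
    rw [himg, Finset.image_val_of_injOn hinj, Multiset.map_map]
    refine Multiset.map_congr rfl fun a ha => ?_
    have ha' := Finset.mem_filter.1 (Finset.mem_def.2 ha)
    simp only [Function.comp_apply]
    congr 1
    ext i
    rw [Equiv.Perm.mem_support_cycleOf_iff' ha'.2, mem_cycleBlock_iff_sameCycle ha'.1]
  · symm
    rw [Multiset.eq_replicate]
    have hfix : ((cycleReps σ).filter fun a => ¬ σ a ≠ a) = σ.supportᶜ := by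
      ext a
      rw [Finset.mem_filter, Finset.mem_compl, Equiv.Perm.mem_support]
      refine ⟨fun h => h.2, fun h => ⟨?_, h⟩⟩
      rw [not_not] at h
      exact Finset.mem_image.2 ⟨a, Finset.mem_univ a, cycleRep_eq_self_of_fixed h⟩
    constructor
    · rw [Multiset.card_map, hfix, Finset.card_val, Finset.card_compl]
    · intro k hk
      obtain ⟨a, ha, rfl⟩ := Multiset.mem_map.1 hk
      have ha' := Finset.mem_filter.1 (Finset.mem_def.2 ha)
      rw [Finset.card_eq_one]
      refine ⟨a, ?_⟩
      ext i
      rw [mem_cycleBlock_iff_sameCycle ha'.1, Finset.mem_singleton]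
      exact ⟨fun h => (h.eq_of_left (not_not.1 ha'.2)).symm, fun h => h ▸ Equiv.Perm.SameCycle.refl _ _⟩

lemma wreathMatrix_apply (z : Fin N → Circle) (i j : Fin N) :
    wreathMatrix σ z i j = if i = σ j then (z i : ℂ) else 0 := by
  rw [wreathMatrix, Matrix.diagonal_mul, Matrix.of_apply, mul_ite, mul_one, mul_zero]

open Polynomial in
-- An entry `(i, j)` can be nonzero only if `i = σ j`, hence only within one cycle. The matrix is
-- thus block diagonal for `cycleRep σ`, and each block is a weighted cycle.
lemma wreathMatrix_charpoly (z : Fin N → Circle) :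
    (wreathMatrix σ z).charpoly = ∏ a ∈ cycleReps σ,
      (X ^ (cycleBlock σ a).card - C ((∏ i ∈ cycleBlock σ a, z i : Circle) : ℂ)) := by
  have happ : ∀ i, cycleRep σ (σ i) = cycleRep σ i := fun i =>
    cycleRep_eq_iff.2 (Equiv.Perm.sameCycle_apply_left.2 (Equiv.Perm.SameCycle.refl _ _))
  have hblock : (wreathMatrix σ z).BlockTriangular (cycleRep σ) := by
    intro i j hij
    rw [wreathMatrix_apply, if_neg]
    rintro rfl
    rw [happ] at hij
    exact lt_irrefl _ hij
  rw [hblock.charpoly]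
  refine Finset.prod_congr rfl fun a ha => ?_
  let τ : Equiv.Perm {i // cycleRep σ i = a} := σ.subtypePerm fun i => by rw [happ]
  have : Nonempty {i // cycleRep σ i = a} := ⟨⟨a, cycleRep_of_mem ha⟩⟩
  have hτ : ∀ i j, τ.SameCycle i j := fun i j => by
    rw [Equiv.Perm.sameCycle_subtypePerm, ← cycleRep_eq_iff, i.2, j.2]
  have hM : (wreathMatrix σ z).toSquareBlock (cycleRep σ) a =
      Matrix.of fun i j => if i = τ j then (z i : ℂ) else 0 := by
    ext i j
    rw [Matrix.toSquareBlock_def, Matrix.of_apply, Matrix.of_apply, wreathMatrix_apply]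
    simp [τ, Subtype.ext_iff]
  rw [hM, charpoly_cyclic τ hτ]
  congr 2
  · rw [Fintype.card_subtype]; rfl
  · have hcoe : ((∏ i ∈ cycleBlock σ a, z i : Circle) : ℂ) = ∏ i ∈ cycleBlock σ a, (z i : ℂ) :=
      map_prod Circle.coeHom _ _
    rw [hcoe, cycleBlock]
    exact (Finset.prod_subtype (Finset.univ.filter fun i => cycleRep σ i = a)
      (fun i => by simp) fun i => (z i : ℂ)).symm

open Polynomial in
-- As `y` is a nonzero number of modulus one, the roots are simple and lie on the circle, where the
-- extension of `F` takes the values of `F`.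
lemma sum_roots_X_pow_sub_C (F : Circle → ℂ) {k : ℕ} (hk : k ≠ 0) (y : Circle) :
    ((X ^ k - C (y : ℂ)).roots.map (Function.extend (fun w : Circle => (w : ℂ)) F 0)).sum =
      k * rootAverage F k y := by
  have hk' : (k : ℂ) ≠ 0 := by exact_mod_cast hk
  have hnodup : (X ^ k - C (y : ℂ)).roots.Nodup :=
    nodup_roots (separable_X_pow_sub_C _ hk' (Circle.coe_ne_zero y))
  have hp : (X ^ k - C (y : ℂ)) ≠ 0 := X_pow_sub_C_ne_zero (Nat.pos_of_ne_zero hk) _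
  have himg : (((X ^ k - C (y : ℂ)).roots.toFinset : Finset ℂ) : Set ℂ) =
      (fun w : Circle => (w : ℂ)) '' {w : Circle | w ^ k = y} := by
    ext x
    simp only [Finset.mem_coe, Multiset.mem_toFinset, mem_roots hp, IsRoot.def, eval_sub, eval_pow,
      eval_X, eval_C, Set.mem_image, Set.mem_ofPred_eq, sub_eq_zero]
    constructor
    · intro hx
      have hnorm : ‖x‖ = 1 := by
        have := congrArg norm hx
        rw [norm_pow, Circle.norm_coe] at this
        exact (pow_eq_one_iff_of_nonneg (norm_nonneg _) hk).1 this
      refine ⟨⟨x, mem_sphere_zero_iff_norm.2 hnorm⟩, ?_, rfl⟩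
      exact Circle.ext hx
    · rintro ⟨w, hw, rfl⟩
      rw [← hw]; simp
  have hsum : ((X ^ k - C (y : ℂ)).roots.map
      (Function.extend (fun w : Circle => (w : ℂ)) F 0)).sum =
      ∑ x ∈ (X ^ k - C (y : ℂ)).roots.toFinset,
        Function.extend (fun w : Circle => (w : ℂ)) F 0 x := by
    rw [Finset.sum, Multiset.toFinset_val, Multiset.dedup_eq_self.2 hnodup]
  rw [hsum, ← finsum_mem_coe_finset, himg]
  refine (finsum_mem_image (s := {w : Circle | w ^ k = y}) (g := fun w : Circle => (w : ℂ))
    (f := Function.extend (fun w : Circle => (w : ℂ)) F 0) Circle.coe_injective.injOn).trans ?_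
  rw [rootAverage, ← mul_assoc, mul_one_div_cancel hk', one_mul]
  exact finsum_mem_congr rfl fun w _ => Circle.coe_injective.extend_apply F 0 w

/-- The trace as a sum over the cycles. -/
theorem wreathTrace_eq_sum (F : Circle → ℂ) (z : Fin N → Circle) :
    wreathTrace F σ z = ∑ a ∈ cycleReps σ, ((cycleBlock σ a).card : ℂ) *
      rootAverage F (cycleBlock σ a).card (∏ i ∈ cycleBlock σ a, z i) := by
  rw [wreathTrace, wreathMatrix_charpoly, Polynomial.roots_prod]
  · rw [Multiset.map_bind, Multiset.sum_bind, Finset.sum]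
    congr 1
    refine Multiset.map_congr rfl fun a ha => ?_
    exact sum_roots_X_pow_sub_C F (card_cycleBlock_pos (Finset.mem_def.2 ha)).ne' _
  · rw [Finset.prod_ne_zero_iff]
    intro a ha
    exact Polynomial.X_pow_sub_C_ne_zero (card_cycleBlock_pos ha) _

end Blocks

/-! ### Coefficients of series in the class `eF(r, ϑ, γ)`. -/

/-- Two power series with the same sum near the origin have the same coefficients. -/
lemma eq_of_hasSum_of_hasSum {u v : ℕ → ℂ} {f : ℂ → ℂ} {r : ℝ} (hr : 0 < r)
    (hu : ∀ t : ℂ, ‖t‖ < r → HasSum (fun n => u n * t ^ n) (f t))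
    (hv : ∀ t : ℂ, ‖t‖ < r → HasSum (fun n => v n * t ^ n) (f t)) : u = v := by
  have h : HasFPowerSeriesAt (0 : ℂ → ℂ)
      (FormalMultilinearSeries.ofScalars ℂ fun n => u n - v n) 0 := by
    rw [hasFPowerSeriesAt_iff]
    filter_upwards [Metric.ball_mem_nhds (0 : ℂ) hr] with t ht
    rw [mem_ball_zero_iff] at ht
    simp only [FormalMultilinearSeries.coeff_ofScalars, smul_eq_mul, Pi.zero_apply]
    convert! (hu t ht).sub (hv t ht) using 1
    · ext n; ring
    · simp
  ext n
  have := congrArg (fun p => FormalMultilinearSeries.coeff p n) h.eq_zero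
  rw [FormalMultilinearSeries.coeff_ofScalars] at this
  have h0 : (0 : FormalMultilinearSeries ℂ ℂ ℂ).coeff n = 0 := rfl
  rw [h0] at this
  exact sub_eq_zero.1 this

namespace ClassEF

variable {r ϑ γ : ℝ} {g : PowerSeries ℂ}

/-- Subtracting the Taylor series of the logarithm from `g` gives a second expansion of the same
function as `g₀`; uniqueness identifies the coefficients. -/
lemma isBigO_coeff_sub (hg : ClassEF r ϑ γ g) :
    (fun n : ℕ => PowerSeries.coeff n g * (r : ℂ) ^ n - ϑ / n) =O[atTop]
      fun n : ℕ => (n : ℝ) ^ (-1 - γ) := by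
  have hr := hg.r_pos
  have hrC : (r : ℂ) ≠ 0 := by exact_mod_cast hr.ne'
  obtain ⟨g₀, h₀, hO⟩ := hg.expansion
  have hlog : ∀ t : ℂ, ‖t‖ < r →
      HasSum (fun n : ℕ => (PowerSeries.coeff n g - ϑ / (r : ℂ) ^ n / n) * t ^ n)
        ((∑' n : ℕ, PowerSeries.coeff n g * t ^ n) - ϑ * Complex.log (1 / (1 - t / r))) := by
    intro t ht
    have htr : ‖t / r‖ < 1 := by
      rw [norm_div, Complex.norm_real, Real.norm_of_nonneg hr.le, div_lt_one hr]; exact ht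
    have h1 := (Complex.hasSum_taylorSeries_neg_log htr).mul_left (ϑ : ℂ)
    have hre : 0 < (1 - t / r).re := by
      have := (Complex.re_le_norm (t / r)).trans_lt htr
      rw [Complex.sub_re, Complex.one_re]
      linarith
    -- The real part of `1 - t / r` is positive, so the branch cut is avoided.
    have hlog' : Complex.log (1 / (1 - t / r)) = -Complex.log (1 - t / r) := by
      rw [one_div, Complex.log_inv]
      rw [Ne, Complex.arg_eq_pi_iff]
      intro h; linarith [h.1]
    rw [hlog']
    convert! (hg.summable t ht).hasSum.sub h1 using 1
    ext n
    rw [div_pow]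
    ring
  have hcoeff : ∀ n : ℕ, PowerSeries.coeff n g₀ = PowerSeries.coeff n g - ϑ / (r : ℂ) ^ n / n :=
    fun n => congrFun (eq_of_hasSum_of_hasSum hr h₀ hlog) n
  have e1 : (fun n : ℕ => PowerSeries.coeff n g * (r : ℂ) ^ n - ϑ / n) =
      fun n : ℕ => PowerSeries.coeff n g₀ * ((r ^ n : ℝ) : ℂ) := by
    ext n
    rw [hcoeff n]
    push_cast
    field_simp
  rw [e1]
  refine (Asymptotics.IsBigO.mul hO (g₂ := fun n : ℕ => (r ^ n : ℝ))
    (Asymptotics.IsBigO.of_norm_left ?_)).congr_right fun n => ?_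
  · refine Asymptotics.IsBigO.of_bound 1 (Eventually.of_forall fun n => ?_)
    rw [Complex.norm_real, norm_norm, one_mul]
  · rw [Real.rpow_neg hr.le, Real.rpow_natCast]
    field_simp

end ClassEF

/-! ### Perturbation of the cycle weights. -/

section WeightRatio

open PowerSeries

variable {θ : ℕ → ℝ} {r ϑ γ : ℝ}

/-- The power series of the deviations `(θ_k r ^ k - ϑ) / k`. -/
noncomputable def deviationSeries (θ : ℕ → ℝ) (r ϑ : ℝ) : PowerSeries ℂ :=
  -- Division by zero gives constant coefficient `0`, whatever `θ 0` is.
  mk fun n => ((θ n * r ^ n - ϑ) / n : ℝ)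

lemma isBigO_coeff_deviationSeries (hg : ClassEF r ϑ γ (genSeries θ)) :
    (fun n : ℕ => coeff n (deviationSeries θ r ϑ)) =O[atTop] fun n : ℕ => (n : ℝ) ^ (-1 - γ) := by
  refine hg.isBigO_coeff_sub.congr' ?_ EventuallyEq.rfl
  filter_upwards [eventually_gt_atTop 0] with n hn
  simp only [genSeries, deviationSeries, coeff_mk, hn.ne', if_false]
  push_cast
  ring

lemma summable_coeff_deviationSeries (hg : ClassEF r ϑ γ (genSeries θ)) :
    Summable fun n => ‖coeff n (deviationSeries θ r ϑ)‖ :=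
  summable_of_isBigO_nat (Real.summable_nat_rpow.2 (by linarith [hg.gamma_pos]))
    (isBigO_coeff_deviationSeries hg).norm_left

lemma tendsto_mul_coeff_deviationSeries (hg : ClassEF r ϑ γ (genSeries θ)) :
    Tendsto (fun n : ℕ => (n : ℂ) * coeff n (deviationSeries θ r ϑ)) atTop (𝓝 0) := by
  have h1 : Tendsto (fun n : ℕ => (n : ℝ) ^ (-γ)) atTop (𝓝 0) :=
    (tendsto_rpow_neg_atTop hg.gamma_pos).comp tendsto_natCast_atTop_atTop
  refine Asymptotics.IsBigO.trans_tendsto ?_ h1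
  have h2 : (fun n : ℕ => (n : ℂ)) =O[atTop] fun n : ℕ => (n : ℝ) :=
    Asymptotics.IsBigO.of_bound 1 (Eventually.of_forall fun n => by simp)
  refine (h2.mul (isBigO_coeff_deviationSeries hg)).congr' EventuallyEq.rfl ?_
  filter_upwards [eventually_gt_atTop 0] with n hn
  have hn' : (0 : ℝ) < n := by exact_mod_cast hn
  nth_rewrite 1 [← Real.rpow_one (n : ℝ)]
  rw [← Real.rpow_add hn']
  congr 1
  ring

lemma exists_bound_mul_pow (hg : ClassEF r ϑ γ (genSeries θ)) :
    ∃ A : ℝ, ∀ n : ℕ, |θ n * r ^ n| ≤ A := by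
  obtain ⟨A, hA⟩ := (tendsto_mul_coeff_deviationSeries hg).norm.bddAbove_range
  refine ⟨max (|θ 0|) (A + |ϑ|), fun n => ?_⟩
  rcases Nat.eq_zero_or_pos n with rfl | hn
  · simp
  · refine le_max_of_le_right ?_
    have h1 := hA ⟨n, rfl⟩
    have h2 : (n : ℂ) * coeff n (deviationSeries θ r ϑ) = ((θ n * r ^ n - ϑ : ℝ) : ℂ) := by
      have : (n : ℂ) ≠ 0 := by exact_mod_cast hn.ne'
      rw [deviationSeries, coeff_mk]
      push_cast
      field_simp
    simp only [h2, Complex.norm_real, Real.norm_eq_abs] at h1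
    calc |θ n * r ^ n| = |(θ n * r ^ n - ϑ) + ϑ| := by rw [sub_add_cancel]
      _ ≤ _ := (abs_add_le _ _).trans (by linarith)

lemma permAverage_pos (hθ : ∀ k : ℕ, 1 ≤ k → 0 < θ k) (n : ℕ) :
    ∃ h : ℝ, 0 < h ∧ permAverage (fun k => (θ k : ℂ)) n = h := by
  refine ⟨(1 / (n.factorial : ℝ)) * ∑ σ : Equiv.Perm (Fin n), (σ.partition.parts.map θ).prod,
    mul_pos (by positivity) (Finset.sum_pos (fun σ _ => ?_) Finset.univ_nonempty), ?_⟩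
  · refine Multiset.prod_pos fun a ha => ?_
    obtain ⟨k, hk, rfl⟩ := Multiset.mem_map.1 ha
    exact hθ k (σ.partition.parts_pos hk)
  · have : ∀ m : Multiset ℕ, ((m.map θ).prod : ℂ) = (m.map fun k => (θ k : ℂ)).prod := fun m => by
      induction m using Multiset.induction_on with
      | empty => simp
      | cons a s ih => simp [ih]
    rw [permAverage]
    push_cast
    simp_rw [this]

/-- Perturbing the cycle weights by factors that are summably close to one. -/
theorem tendsto_permAverage_div (hθ : ∀ k : ℕ, 1 ≤ k → 0 < θ k) (hϑ : 0 < ϑ)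
    (hg : ClassEF r ϑ γ (genSeries θ)) (φ : ℕ → ℂ)
    (hφ : Summable fun n : ℕ => ((n : ℝ) + 1) ^ max (1 - ϑ) 0 *
      ‖((θ n * r ^ n / n : ℝ) : ℂ) * (φ n - 1)‖) :
    Tendsto (fun n => permAverage (fun k => θ k * φ k) n / permAverage (fun k => (θ k : ℂ)) n)
      atTop (𝓝 (Complex.exp (∑' n : ℕ, ((θ n * r ^ n / n : ℝ) : ℂ) * (φ n - 1)))) := by
  have hrC : (r : ℂ) ≠ 0 := by exact_mod_cast hg.r_pos.ne'
  set C : PowerSeries ℂ := mk fun n => ((θ n * r ^ n / n : ℝ) : ℂ) * (φ n - 1) with hC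
  have hmulC : ∀ n : ℕ, n ≠ 0 → (n : ℂ) * coeff n C = θ n * φ n * r ^ n - θ n * r ^ n := by
    intro n hn
    have : (n : ℂ) ≠ 0 := by exact_mod_cast hn
    rw [hC, coeff_mk]
    push_cast
    field_simp
  have hA : (mk fun n => if n = 0 then 0 else (θ n : ℂ) * r ^ n) =
      (mk fun n => if n = 0 then 0 else (ϑ : ℂ)) + X * derivative ℂ (deviationSeries θ r ϑ) := by
    ext n
    rw [map_add, IsExpOf.coeff_euler, coeff_mk, coeff_mk]
    split_ifs with hn
    · simp [hn]
    · have : (n : ℂ) ≠ 0 := by exact_mod_cast hn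
      rw [deviationSeries, coeff_mk]
      push_cast
      field_simp
      ring
  -- Both averages are taken with the weights multiplied by `r ^ k`, which moves the singularity to
  -- `1`; the common factor `r ^ n` cancels in the quotient.
  have hH := isExpOf_permAverage fun k => (θ k : ℂ) * r ^ k
  have hH' := isExpOf_permAverage fun k => (θ k : ℂ) * φ k * r ^ k
  have hA' : (mk fun n => if n = 0 then 0 else (θ n : ℂ) * φ n * r ^ n) =
      (mk fun n => if n = 0 then 0 else (θ n : ℂ) * r ^ n) + X * derivative ℂ C := by
    ext n
    rw [map_add, IsExpOf.coeff_euler, coeff_mk, coeff_mk]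
    split_ifs with hn
    · simp [hn]
    · rw [hmulC n hn]; ring
  rw [hA'] at hH'
  have hne : ∀ n, coeff n (mk (permAverage fun k => (θ k : ℂ) * r ^ k)) ≠ 0 := fun n => by
    obtain ⟨h, hpos, he⟩ := permAverage_pos hθ n
    rw [coeff_mk, permAverage_mul_pow, he]
    exact mul_ne_zero (pow_ne_zero _ hrC) (by exact_mod_cast hpos.ne')
  have := tendsto_coeff_div_coeff hϑ (B := deviationSeries θ r ϑ) (C := C)
    (by simp [deviationSeries]) (by simp [hC]) (summable_coeff_deviationSeries hg)
    (tendsto_mul_coeff_deviationSeries hg) (by simpa [hC] using hφ) hA hH hH' hne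
  simp only [hC, coeff_mk] at this
  refine this.congr fun n => ?_
  rw [permAverage_mul_pow, permAverage_mul_pow (fun k => (θ k : ℂ)),
    mul_div_mul_left _ _ (pow_ne_zero _ hrC)]

end WeightRatio

/-! ### Characters of the real plane. -/

section UnitChar

/-- The character `x ↦ exp (i ⟨x, t⟩)` of the real vector space `ℂ`. -/
noncomputable def unitChar (t x : ℂ) : ℂ := Complex.exp ((inner ℝ x t : ℝ) * Complex.I)

lemma unitChar_zero (t : ℂ) : unitChar t 0 = 1 := by simp [unitChar]

lemma unitChar_add (t x y : ℂ) : unitChar t (x + y) = unitChar t x * unitChar t y := by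
  rw [unitChar, inner_add_left, Complex.ofReal_add, add_mul, Complex.exp_add]
  rfl

lemma unitChar_sum {ι : Type*} (t : ℂ) (s : Finset ι) (f : ι → ℂ) :
    unitChar t (∑ i ∈ s, f i) = ∏ i ∈ s, unitChar t (f i) := by
  classical
  induction s using Finset.induction_on with
  | empty => simp [unitChar_zero]
  | insert a s ha ih => rw [Finset.sum_insert ha, Finset.prod_insert ha, unitChar_add, ih]

lemma norm_unitChar (t x : ℂ) : ‖unitChar t x‖ = 1 := Complex.norm_exp_ofReal_mul_I _

lemma continuous_unitChar (t : ℂ) : Continuous (unitChar t) := by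
  unfold unitChar
  fun_prop

lemma measurable_unitChar (t : ℂ) : Measurable (unitChar t) := (continuous_unitChar t).measurable

lemma norm_unitChar_sub_one_le (t x : ℂ) : ‖unitChar t x - 1‖ ≤ ‖x‖ * ‖t‖ := by
  rw [unitChar, mul_comm]
  exact Real.norm_exp_I_mul_ofReal_sub_one_le.trans (abs_real_inner_le_norm x t)

lemma charFun_map_eq {Ω : Type*} [MeasurableSpace Ω] {μ : Measure Ω} {X : Ω → ℂ}
    (hX : AEMeasurable X μ) (t : ℂ) : charFun (μ.map X) t = ∫ ω, unitChar t (X ω) ∂μ := by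
  rw [charFun_apply]
  exact integral_map hX (continuous_unitChar t).aestronglyMeasurable

end UnitChar

/-! ### Products of independent entries over disjoint blocks. -/

section ProductLaw

variable (ρ : Measure Circle) [IsProbabilityMeasure ρ]

instance instIsProbabilityMeasureProductLaw (k : ℕ) : IsProbabilityMeasure (productLaw ρ k) :=
  Measure.isProbabilityMeasure_map (by fun_prop)

/-- The product of a finite set of independent entries has law `productLaw`. -/
lemma map_prod_eq_productLaw {ι : Type*} [Fintype ι] (B : Finset ι) :
    (Measure.pi fun _ : ι => ρ).map (fun z => ∏ i ∈ B, z i) = productLaw ρ B.card := by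
  let f : Fin B.card → ι := fun j => (B.equivFin.symm j : ι)
  have hf : Function.Injective f := Subtype.val_injective.comp B.equivFin.symm.injective
  have h := Measure.map_infinitePi_infinitePi_of_inj (P := fun _ : ι => ρ) hf
  rw [Measure.infinitePi_eq_pi, Measure.infinitePi_eq_pi] at h
  rw [productLaw, ← h, Measure.map_map (by fun_prop) (by fun_prop)]
  congr 1
  ext1 z
  simp only [Function.comp_apply, f]
  rw [Equiv.prod_comp B.equivFin.symm (fun i : B => z i), Finset.prod_coe_sort B z]

/-- Products over disjoint blocks of independent entries are independent. -/
lemma integral_prod_blocks {ι κ : Type*} [Fintype ι] (B : κ → Finset ι) (R : Finset κ)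
    (hB : (R : Set κ).PairwiseDisjoint B) (f : κ → Circle → ℂ) (hf : ∀ a, Measurable (f a)) :
    ∫ z, ∏ a ∈ R, f a (∏ i ∈ B a, z i) ∂(Measure.pi fun _ : ι => ρ) =
      ∏ a ∈ R, ∫ y, f a y ∂(productLaw ρ (B a).card) := by
  classical
  have hind : iIndepFun (fun (i : ι) (z : ι → Circle) => z i) (Measure.pi fun _ : ι => ρ) := by
    have := iIndepFun_pi (μ := fun _ : ι => ρ) (X := fun (_ : ι) (x : Circle) => x)
      (fun i => aemeasurable_id)
    exact this
  induction R using Finset.induction_on with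
  | empty => simp
  | insert a R ha ih =>
    have hdisj : Disjoint (B a) (R.biUnion B) := by
      rw [Finset.disjoint_biUnion_right]
      intro b hb
      exact hB (by simp) (by simp [hb]) (fun h => ha (h ▸ hb))
    set T : Finset ι := R.biUnion B with hT
    have hI := hind.indepFun_finset (B a) (T) hdisj (fun i => measurable_pi_apply i)
    have hI2 := hI.comp (φ := fun w : B a → Circle => f a (∏ i, w i))
      (ψ := fun w : T → Circle =>
        ∏ b ∈ R, f b (∏ i ∈ B b, if h : i ∈ T then w ⟨i, h⟩ else 1))
      (by fun_prop) (by
        refine Finset.measurable_fun_prod _ fun b _ => (hf b).comp ?_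
        refine Finset.measurable_fun_prod _ fun i _ => ?_
        split_ifs
        · fun_prop
        · fun_prop)
    have e1 : ((fun w : B a → Circle => f a (∏ i, w i)) ∘
        fun (z : ι → Circle) (i : B a) => z i) = fun z => f a (∏ i ∈ B a, z i) := by
      ext z
      simp only [Function.comp_apply]
      rw [Finset.prod_coe_sort (B a) z]
    have e2 : ((fun w : T → Circle =>
        ∏ b ∈ R, f b (∏ i ∈ B b, if h : i ∈ T then w ⟨i, h⟩ else 1)) ∘
        fun (z : ι → Circle) (i : T) => z i) =
        fun z => ∏ b ∈ R, f b (∏ i ∈ B b, z i) := by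
      ext z
      simp only [Function.comp_apply]
      refine Finset.prod_congr rfl fun b hb => ?_
      congr 1
      refine Finset.prod_congr rfl fun i hi => ?_
      rw [dif_pos (hT ▸ Finset.mem_biUnion.2 ⟨b, hb, hi⟩)]
    rw [e1, e2] at hI2
    simp_rw [Finset.prod_insert ha]
    have hm1 : Measurable fun z : ι → Circle => f a (∏ i ∈ B a, z i) :=
      (hf a).comp (by fun_prop)
    have hm2 : Measurable fun z : ι → Circle => ∏ b ∈ R, f b (∏ i ∈ B b, z i) :=
      Finset.measurable_fun_prod _ fun b _ => (hf b).comp (by fun_prop)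
    rw [hI2.integral_fun_mul_eq_mul_integral hm1.aestronglyMeasurable hm2.aestronglyMeasurable,
      ih (hB.subset (by simp)), ← map_prod_eq_productLaw ρ (B a),
      integral_map (by fun_prop) (hf a).aestronglyMeasurable]

end ProductLaw

/-! ### Integration against the Ewens measure. -/

section Ewens

variable (θ : ℕ → ℝ) (N : ℕ)

lemma ewensWeight_eq (σ : Equiv.Perm (Fin N)) :
    ewensWeight θ σ = (σ.partition.parts.map θ).prod := by
  rw [Finset.prod_multiset_map_count]
  symm
  refine Finset.prod_subset (fun k hk => ?_) fun k _ hk => ?_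
  · rw [Multiset.mem_toFinset] at hk
    rw [Finset.mem_Icc]
    refine ⟨σ.partition.parts_pos hk, ?_⟩
    calc k ≤ σ.partition.parts.sum := Multiset.le_sum_of_mem hk
      _ = N := by rw [σ.partition.parts_sum, Fintype.card_fin]
  · rw [Multiset.mem_toFinset] at hk
    rw [Multiset.count_eq_zero_of_notMem hk, pow_zero]

lemma coe_prod_map (x : ℕ → ℝ) (m : Multiset ℕ) :
    ((m.map x).prod : ℂ) = (m.map fun k => (x k : ℂ)).prod := by
  induction m using Multiset.induction_on with
  | empty => simp
  | cons a s ih => simp [ih]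

lemma coe_ewensNorm : (ewensNorm θ N : ℂ) = permAverage (fun k => (θ k : ℂ)) N := by
  rw [ewensNorm, permAverage]
  push_cast
  simp_rw [ewensWeight_eq, coe_prod_map]

variable {θ}

lemma ewensNorm_pos (hθ : ∀ k : ℕ, 1 ≤ k → 0 < θ k) : 0 < ewensNorm θ N := by
  obtain ⟨h, hpos, he⟩ := permAverage_pos hθ N
  rw [← coe_ewensNorm] at he
  rw [Complex.ofReal_inj.1 he]
  exact hpos

lemma ewensWeight_nonneg (hθ : ∀ k : ℕ, 1 ≤ k → 0 < θ k) (σ : Equiv.Perm (Fin N)) :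
    0 ≤ ewensWeight θ σ :=
  Finset.prod_nonneg fun k hk => pow_nonneg (hθ k (Finset.mem_Icc.1 hk).1).le _

lemma integral_ewensMeasure (hθ : ∀ k : ℕ, 1 ≤ k → 0 < θ k) (x : ℕ → ℂ) :
    ∫ σ, (σ.partition.parts.map x).prod ∂(ewensMeasure θ N) =
      permAverage (fun k => θ k * x k) N / permAverage (fun k => (θ k : ℂ)) N := by
  rw [ewensMeasure, integral_finsetSum_measure]
  · have hN := ewensNorm_pos N hθ
    have hf : (N.factorial : ℂ) ≠ 0 := by exact_mod_cast N.factorial_ne_zero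
    have hn : (ewensNorm θ N : ℂ) ≠ 0 := by exact_mod_cast hN.ne'
    rw [← coe_ewensNorm, permAverage, Finset.mul_sum, Finset.sum_div]
    refine Finset.sum_congr rfl fun σ _ => ?_
    rw [integral_smul_measure, integral_dirac, ENNReal.toReal_ofReal
      (mul_nonneg (by positivity) (ewensWeight_nonneg N hθ σ)), ewensWeight_eq,
      Multiset.prod_map_mul, ← coe_prod_map, Complex.real_smul]
    push_cast
    field_simp
  · intro σ _
    exact Integrable.smul_measure (integrable_dirac (by simp)) ENNReal.ofReal_ne_top

end Ewens

/-! ### The characteristic function of the trace. -/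

section TraceLaw

variable {θ : ℕ → ℝ} {ρ : Measure Circle} [IsProbabilityMeasure ρ] {F : Circle → ℂ}

/-- A measurable version of the trace. -/
noncomputable def traceVersion (G : ℕ → Circle → ℂ) {N : ℕ}
    (p : Equiv.Perm (Fin N) × (Fin N → Circle)) : ℂ :=
  ∑ a ∈ cycleReps p.1, ((cycleBlock p.1 a).card : ℂ) *
    G (cycleBlock p.1 a).card (∏ i ∈ cycleBlock p.1 a, p.2 i)

lemma measurable_traceVersion {G : ℕ → Circle → ℂ} (hG : ∀ k, Measurable (G k)) (N : ℕ) :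
    Measurable (traceVersion G (N := N)) := by
  have : MeasurableSingletonClass (Equiv.Perm (Fin N)) := ⟨fun _ => trivial⟩
  refine measurable_from_prod_countable_right fun s => ?_
  dsimp only [traceVersion]
  refine Finset.measurable_fun_sum (cycleReps s) fun a _ => Measurable.const_mul ?_ _
  exact (hG _).comp (by fun_prop)

lemma integral_unitChar_traceVersion {G : ℕ → Circle → ℂ} (hG : ∀ k, Measurable (G k)) {N : ℕ}
    (s : Equiv.Perm (Fin N)) (t : ℂ) :
    ∫ z, unitChar t (traceVersion G (s, z)) ∂(Measure.pi fun _ : Fin N => ρ) =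
      (s.partition.parts.map fun k : ℕ =>
        ∫ y, unitChar t (k * G k y) ∂(productLaw ρ k)).prod := by
  simp only [traceVersion, unitChar_sum]
  rw [integral_prod_blocks ρ (cycleBlock s) (cycleReps s)
    (f := fun a y => unitChar t ((cycleBlock s a).card * G (cycleBlock s a).card y)),
    parts_partition_eq_map_card, Multiset.map_map]
  · rfl
  · intro a _ b _ hab
    rw [Function.onFun, Finset.disjoint_left]
    intro i hi hi'
    exact hab ((mem_cycleBlock.1 hi).symm.trans (mem_cycleBlock.1 hi'))
  · intro a
    exact (measurable_unitChar t).comp ((hG _).const_mul _)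

variable {Ω : Type*} [MeasurableSpace Ω] {μ : Measure Ω} {N : ℕ}
  {σ : Ω → Equiv.Perm (Fin N)} {z : Fin N → Ω → Circle}

/-- `F` itself need not be measurable, so the trace is compared with a measurable version. The
exceptional null set is taken uniformly over all finite blocks, because the blocks that occur depend
on the random permutation. -/
lemma wreathTrace_ae_eq {G : ℕ → Circle → ℂ}
    (hGF : ∀ k, 1 ≤ k → rootAverage F k =ᵐ[productLaw ρ k] G k)
    (hz : HasLaw (fun ω j => z j ω) (Measure.pi fun _ : Fin N => ρ) μ) :
    (fun ω => wreathTrace F (σ ω) (fun j => z j ω)) =ᵐ[μ]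
      fun ω => traceVersion G (σ ω, fun j => z j ω) := by
  have h : ∀ᵐ ω ∂μ, ∀ B : Finset (Fin N), 0 < B.card →
      rootAverage F B.card (∏ i ∈ B, z i ω) = G B.card (∏ i ∈ B, z i ω) := by
    rw [ae_all_iff]
    intro B
    by_cases hB : 0 < B.card
    · have h1 := hGF B.card hB
      rw [← map_prod_eq_productLaw ρ B, ← hz.map_eq] at h1
      have h2 := ae_of_ae_map (by fun_prop) h1
      filter_upwards [ae_of_ae_map hz.aemeasurable h2] with ω hω _ using hω
    · exact Eventually.of_forall fun ω h => absurd h hB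
  filter_upwards [h] with ω hω
  rw [wreathTrace_eq_sum, traceVersion]
  exact Finset.sum_congr rfl fun a ha => by rw [hω _ (card_cycleBlock_pos ha)]

/-- The characteristic function of the trace. -/
theorem charFun_wreathTrace [IsProbabilityMeasure μ] (hθ : ∀ k : ℕ, 1 ≤ k → 0 < θ k)
    {G : ℕ → Circle → ℂ}
    (hG : ∀ k, Measurable (G k))
    (hGF : ∀ k, 1 ≤ k → rootAverage F k =ᵐ[productLaw ρ k] G k)
    (hσ : HasLaw σ (ewensMeasure θ N) μ) (hz : ∀ j, HasLaw (z j) ρ μ) (hz_indep : iIndepFun z μ)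
    (hσz : IndepFun σ (fun ω j => z j ω) μ) :
    AEMeasurable (fun ω => wreathTrace F (σ ω) (fun j => z j ω)) μ ∧
    ∀ t : ℂ, charFun (μ.map fun ω => wreathTrace F (σ ω) (fun j => z j ω)) t =
      permAverage (fun k => θ k * ∫ y, unitChar t (k * G k y) ∂(productLaw ρ k)) N /
        permAverage (fun k => (θ k : ℂ)) N := by
  have hzlaw := hz_indep.hasLaw_pi hz
  have hpair := hσz.hasLaw_prod hσ hzlaw
  have hae := wreathTrace_ae_eq (σ := σ) hGF hzlaw
  have hmeas := measurable_traceVersion hG N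
  have : IsProbabilityMeasure (ewensMeasure θ N) := hσ.isProbabilityMeasure_iff.1 inferInstance
  refine ⟨(hmeas.comp_aemeasurable hpair.aemeasurable).congr hae.symm, fun t => ?_⟩
  rw [Measure.map_congr hae, charFun_map_eq (X := fun ω => traceVersion G (σ ω, fun j => z j ω))
    (hmeas.comp_aemeasurable hpair.aemeasurable)]
  have hm : Measurable fun p => unitChar t (traceVersion G (N := N) p) :=
    (measurable_unitChar t).comp hmeas
  have h1 := hpair.integral_comp (f := fun p => unitChar t (traceVersion G p))
    hm.aestronglyMeasurable
  refine h1.trans ?_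
  -- The entries are integrated first, with the permutation fixed; a class function of the cycle
  -- lengths remains.
  rw [integral_prod]
  · simp_rw [integral_unitChar_traceVersion hG]
    exact integral_ewensMeasure N hθ fun k => ∫ y, unitChar t (k * G k y) ∂(productLaw ρ k)
  · exact Integrable.of_bound hm.aestronglyMeasurable 1
      (Eventually.of_forall fun p => (norm_unitChar t _).le)

end TraceLaw

/-! ### Mean and generating function of the Poisson law. -/

section Poisson

open scoped NNReal ENNReal

lemma lintegral_natCast_poissonMeasure (r : ℝ≥0) :
    ∫⁻ n, (n : ℝ≥0∞) ∂(poissonMeasure r) = r := by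
  have hs : HasSum (fun n : ℕ => Real.exp (-r) * (r : ℝ) ^ n / n.factorial * n) (r : ℝ) := by
    rw [← hasSum_nat_add_iff' 1]
    have h := (hasSum_one_poissonMeasure r).mul_left (r : ℝ)
    rw [mul_one] at h
    simp only [Finset.range_one, Finset.sum_singleton, CharP.cast_eq_zero, mul_zero, sub_zero]
    refine h.congr_fun fun n => ?_
    rw [Nat.factorial_succ]
    push_cast
    have h1 : ((n : ℝ) + 1) ≠ 0 := by positivity
    have h2 : (n.factorial : ℝ) ≠ 0 := by positivity
    field_simp
    ring
  have h0 : ∀ n : ℕ, 0 ≤ Real.exp (-r) * (r : ℝ) ^ n / n.factorial * n := fun n => by positivity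
  rw [poissonMeasure, lintegral_sum_measure]
  have e : ∀ n : ℕ, ∫⁻ a, (a : ℝ≥0∞) ∂(ENNReal.ofReal
      (Real.exp (-r) * (r : ℝ) ^ n / n.factorial) • Measure.dirac n) =
      ENNReal.ofReal (Real.exp (-r) * (r : ℝ) ^ n / n.factorial * n) := fun n => by
    rw [lintegral_smul_measure, lintegral_dirac, smul_eq_mul,
      ENNReal.ofReal_mul (by positivity), ENNReal.ofReal_natCast]
  simp_rw [e]
  rw [← ENNReal.ofReal_tsum_of_nonneg h0 hs.summable, hs.tsum_eq, ENNReal.ofReal_coe_nnreal]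

lemma integral_pow_poissonMeasure (r : ℝ≥0) (x : ℂ) :
    ∫ n, x ^ n ∂(poissonMeasure r) = Complex.exp (r * (x - 1)) := by
  rw [integral_poissonMeasure]
  have h : ∀ n : ℕ, (Real.exp (-r) * (r : ℝ) ^ n / n.factorial) • x ^ n =
      Complex.exp (-r) * ((r * x) ^ n / n.factorial) := fun n => by
    rw [Complex.real_smul]
    push_cast
    rw [mul_pow]
    ring
  simp_rw [h]
  rw [tsum_mul_left, (NormedSpace.expSeries_div_hasSum_exp ((r : ℂ) * x)).tsum_eq,
    ← Complex.exp_eq_exp_ℂ, ← Complex.exp_add]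
  congr 1
  ring

end Poisson

/-! ### Sums and products with a Poisson number of factors. -/

section CompoundPoisson

open scoped NNReal ENNReal

variable {κ S Ω : Type*} [MeasurableSpace S] [MeasurableSpace Ω]
  {μ : Measure Ω} {P : κ → Ω → ℕ} {Z : κ → ℕ → Ω → S} {Λ : κ → ℝ≥0} {ν : κ → Measure S}

lemma aemeasurable_sum_range {M : Type*} [AddCommMonoid M] [MeasurableSpace M] [MeasurableAdd₂ M]
    {p : Ω → ℕ} {z : ℕ → Ω → S} {h : S → M} (hp : AEMeasurable p μ)
    (hz : ∀ m, AEMeasurable (z m) μ) (hh : Measurable h) :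
    AEMeasurable (fun ω => ∑ m ∈ Finset.range (p ω), h (z m ω)) μ := by
  have h1 : Measurable fun x : ℕ × (ℕ → S) => ∑ m ∈ Finset.range x.1, h (x.2 m) := by
    refine measurable_from_prod_countable_right fun n => ?_
    exact Finset.measurable_fun_sum (Finset.range n) fun m _ => hh.comp (measurable_pi_apply _)
  exact h1.comp_aemeasurable (f := fun ω => (p ω, fun m => z m ω))
    (hp.prodMk (aemeasurable_pi_lambda _ hz))

/-- Wald's identity for a Poisson number of nonnegative summands. -/
lemma lintegral_sum_range_poisson {k : κ} (hP : HasLaw (P k) (poissonMeasure (Λ k)) μ)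
    (hZ : ∀ m, HasLaw (Z k m) (ν k) μ)
    (hPZ : IndepFun (fun ω k => P k ω) (fun ω (p : κ × ℕ) => Z p.1 p.2 ω) μ)
    {h : S → ℝ≥0∞} (hh : Measurable h) :
    ∫⁻ ω, ∑ m ∈ Finset.range (P k ω), h (Z k m ω) ∂μ = Λ k * ∫⁻ y, h y ∂(ν k) := by
  -- The random range becomes a fixed infinite sum with indicators of `m < P k`, to each term of
  -- which independence applies.
  have hsum : ∀ (g : ℕ → ℝ≥0∞) (n : ℕ),
      ∑ m ∈ Finset.range n, g m = ∑' m, (if m < n then 1 else 0) * g m := fun g n => by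
    rw [tsum_eq_sum (s := Finset.range n)]
    · exact Finset.sum_congr rfl fun m hm => by rw [if_pos (Finset.mem_range.1 hm), one_mul]
    · intro m hm
      rw [if_neg (fun h => hm (Finset.mem_range.2 h)), zero_mul]
  have hind : ∀ m : ℕ, Measurable fun n : ℕ => if m < n then (1 : ℝ≥0∞) else 0 :=
    fun m => measurable_of_countable _
  have hPm : ∀ m, AEMeasurable (fun ω => if m < P k ω then (1 : ℝ≥0∞) else 0) μ := fun m =>
    (hind m).comp_aemeasurable hP.aemeasurable
  have hZm : ∀ m, AEMeasurable (fun ω => h (Z k m ω)) μ := fun m =>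
    hh.comp_aemeasurable (hZ m).aemeasurable
  simp_rw [hsum]
  rw [lintegral_tsum (f := fun m ω => (if m < P k ω then 1 else 0) * h (Z k m ω))
    fun m => (hPm m).mul (hZm m)]
  have hterm : ∀ m, ∫⁻ ω, (if m < P k ω then 1 else 0) * h (Z k m ω) ∂μ =
      (∫⁻ ω, (if m < P k ω then 1 else 0) ∂μ) * ∫⁻ y, h y ∂(ν k) := fun m => by
    have hI : IndepFun (fun ω => if m < P k ω then (1 : ℝ≥0∞) else 0) (fun ω => h (Z k m ω)) μ :=
      hPZ.comp (φ := fun p : κ → ℕ => if m < p k then (1 : ℝ≥0∞) else 0)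
        (ψ := fun q : κ × ℕ → S => h (q (k, m))) ((hind m).comp (measurable_pi_apply k))
        (hh.comp (measurable_pi_apply _))
    rw [lintegral_mul_eq_lintegral_mul_lintegral_of_indepFun'' (hPm m) (hZm m) hI,
      (hZ m).lintegral_comp hh.aemeasurable]
  simp_rw [hterm]
  rw [ENNReal.tsum_mul_right, ← lintegral_tsum hPm]
  congr 1
  have hcount : ∀ ω, ∑' m, (if m < P k ω then (1 : ℝ≥0∞) else 0) = (P k ω : ℝ≥0∞) := fun ω => by
    have := hsum (fun _ => 1) (P k ω)
    simp only [mul_one] at this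
    rw [← this]
    simp
  simp_rw [hcount]
  rw [hP.lintegral_comp (f := fun n : ℕ => (n : ℝ≥0∞)) (measurable_of_countable _).aemeasurable,
    lintegral_natCast_poissonMeasure]

/-- A product over a Poisson number of independent factors, jointly over finitely many indices. -/
lemma integral_prod_prod_range [IsProbabilityMeasure μ] [Countable κ]
    (hP : ∀ k, HasLaw (P k) (poissonMeasure (Λ k)) μ)
    (hZ : ∀ k m, HasLaw (Z k m) (ν k) μ) (hP_indep : iIndepFun P μ)
    (hZ_indep : iIndepFun (fun p : κ × ℕ => Z p.1 p.2) μ)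
    (hPZ : IndepFun (fun ω k => P k ω) (fun ω (p : κ × ℕ) => Z p.1 p.2 ω) μ)
    {u : κ → S → ℂ} (hu : ∀ k, Measurable (u k)) (hu1 : ∀ k y, ‖u k y‖ ≤ 1) (s : Finset κ) :
    ∫ ω, ∏ k ∈ s, ∏ m ∈ Finset.range (P k ω), u k (Z k m ω) ∂μ =
      ∏ k ∈ s, Complex.exp (Λ k * (∫ y, u k y ∂(ν k) - 1)) := by
  have hPm : AEMeasurable (fun ω k => P k ω) μ :=
    aemeasurable_pi_lambda _ fun k => (hP k).aemeasurable
  have hZm : AEMeasurable (fun ω (p : κ × ℕ) => Z p.1 p.2 ω) μ :=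
    aemeasurable_pi_lambda _ fun p => (hZ p.1 p.2).aemeasurable
  let Ψ : (κ → ℕ) × (κ × ℕ → S) → ℂ := fun x =>
    ∏ k ∈ s, ∏ m ∈ Finset.range (x.1 k), u k (x.2 (k, m))
  have hΨ : Measurable Ψ := by
    refine Finset.measurable_fun_prod s fun k _ => ?_
    have h1 : Measurable fun x : ℕ × (κ × ℕ → S) =>
        ∏ m ∈ Finset.range x.1, u k (x.2 (k, m)) := by
      refine measurable_from_prod_countable_right fun n => ?_
      exact Finset.measurable_fun_prod (Finset.range n) fun m _ =>
        (hu k).comp (measurable_pi_apply _)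
    exact h1.comp (g := fun x : ℕ × (κ × ℕ → S) => ∏ m ∈ Finset.range x.1, u k (x.2 (k, m)))
      (f := fun x : (κ → ℕ) × (κ × ℕ → S) => (x.1 k, x.2))
      (((measurable_pi_apply k).comp measurable_fst).prodMk measurable_snd)
  have hΨ1 : ∀ x, ‖Ψ x‖ ≤ 1 := fun x => by
    simp only [Ψ, norm_prod]
    exact Finset.prod_le_one (fun _ _ => Finset.prod_nonneg fun _ _ => norm_nonneg _)
      fun k _ => Finset.prod_le_one (fun _ _ => norm_nonneg _) fun m _ => hu1 k _
  have : IsProbabilityMeasure (μ.map fun ω k => P k ω) := Measure.isProbabilityMeasure_map hPm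
  have : IsProbabilityMeasure (μ.map fun ω (p : κ × ℕ) => Z p.1 p.2 ω) :=
    Measure.isProbabilityMeasure_map hZm
  -- With the Poisson counts frozen at `p`, the factors are finitely many independent variables, and
  -- the integral is a product of powers.
  have hinner : ∀ p : κ → ℕ, ∫ ω, Ψ (p, fun q => Z q.1 q.2 ω) ∂μ =
      ∏ k ∈ s, (∫ y, u k y ∂(ν k)) ^ p k := fun p => by
    let A : Finset (Σ _ : κ, ℕ) := s.sigma fun k => Finset.range (p k)
    have hI : iIndepFun (fun a : A => Z a.1.1 a.1.2) μ :=
      hZ_indep.precomp (g := fun a : A => ((a.1.1, a.1.2) : κ × ℕ)) fun a b hab => by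
        rcases a with ⟨⟨a1, a2⟩, ha⟩
        rcases b with ⟨⟨b1, b2⟩, hb⟩
        simp only [Prod.mk.injEq] at hab
        obtain ⟨rfl, rfl⟩ := hab
        rfl
    have h1 := hI.integral_fun_prod_comp (f := fun a : A => u a.1.1)
      (fun a => (hZ _ _).aemeasurable) (fun a => (hu _).aestronglyMeasurable)
    have h2 : ∀ a : A, ∫ ω, u a.1.1 (Z a.1.1 a.1.2 ω) ∂μ = ∫ y, u a.1.1 y ∂(ν a.1.1) := fun a =>
      (hZ a.1.1 a.1.2).integral_comp (hu a.1.1).aestronglyMeasurable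
    simp_rw [h2] at h1
    rw [Finset.prod_coe_sort A (fun a => ∫ y, u a.1 y ∂(ν a.1))] at h1
    have h3 : ∀ ω, ∏ a : A, u a.1.1 (Z a.1.1 a.1.2 ω) = Ψ (p, fun q => Z q.1 q.2 ω) := fun ω => by
      rw [Finset.prod_coe_sort A (fun a => u a.1 (Z a.1 a.2 ω)), Finset.prod_sigma]
    simp_rw [h3] at h1
    rw [h1, Finset.prod_sigma]
    exact Finset.prod_congr rfl fun k _ => by
      simp only [Finset.prod_const, Finset.card_range]
  have hmap : ∫ ω, Ψ (fun k => P k ω, fun q => Z q.1 q.2 ω) ∂μ =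
      ∫ ω, ∏ k ∈ s, (∫ y, u k y ∂(ν k)) ^ P k ω ∂μ := by
    have h1 := integral_map (hPm.prodMk hZm) (f := Ψ) hΨ.aestronglyMeasurable
    rw [← h1, hPZ.map_prod_eq_prod_map_map hPm hZm, integral_prod _
      (Integrable.of_bound hΨ.aestronglyMeasurable 1 (Eventually.of_forall hΨ1))]
    have h2 : ∀ p : κ → ℕ, ∫ q, Ψ (p, q) ∂(μ.map fun ω (p : κ × ℕ) => Z p.1 p.2 ω) =
        ∏ k ∈ s, (∫ y, u k y ∂(ν k)) ^ p k := fun p => by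
      rw [integral_map hZm (f := fun q => Ψ (p, q))
        (hΨ.comp measurable_prodMk_left).aestronglyMeasurable]
      exact hinner p
    simp_rw [h2]
    refine integral_map hPm (f := fun p : κ → ℕ => ∏ k ∈ s, (∫ y, u k y ∂(ν k)) ^ p k) ?_
    refine (Finset.measurable_fun_prod s fun k _ => ?_).aestronglyMeasurable
    exact (measurable_of_countable fun n : ℕ => (∫ y, u k y ∂(ν k)) ^ n).comp
      (measurable_pi_apply k)
  refine hmap.trans ?_
  have hI : iIndepFun (fun k : s => P k) μ := hP_indep.precomp Subtype.val_injective
  have h1 := hI.integral_fun_prod_comp (f := fun (k : s) n => (∫ y, u k y ∂(ν k)) ^ n)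
    (fun k => (hP k).aemeasurable) (fun k => (measurable_of_countable _).aestronglyMeasurable)
  have h2 : ∀ k : s, ∫ ω, (∫ y, u k y ∂(ν k)) ^ P k ω ∂μ =
      Complex.exp (Λ k * (∫ y, u k y ∂(ν k) - 1)) := fun k => by
    rw [← integral_pow_poissonMeasure]
    exact (hP k).integral_comp (f := fun n : ℕ => (∫ y, u k y ∂(ν k)) ^ n)
      (measurable_of_countable _).aestronglyMeasurable
  simp_rw [h2] at h1
  rw [Finset.prod_coe_sort s (fun k => Complex.exp (Λ k * (∫ y, u k y ∂(ν k) - 1)))] at h1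
  rw [← h1]
  refine integral_congr_ae (Eventually.of_forall fun ω => ?_)
  exact (Finset.prod_coe_sort s (fun k => (∫ y, u k y ∂(ν k)) ^ P k ω)).symm

end CompoundPoisson

/-! ### The compound Poisson limit. -/

section Limit

open scoped NNReal ENNReal

variable {θ : ℕ → ℝ} {r ϑ γ : ℝ} {ρ : Measure Circle} {F : Circle → ℂ}

lemma exists_measurable_version
    (hF : ∀ k : ℕ+, Integrable (rootAverage F k) (productLaw ρ k)) :
    ∃ G : ℕ → Circle → ℂ, (∀ k, Measurable (G k)) ∧
      ∀ k : ℕ, 1 ≤ k → rootAverage F k =ᵐ[productLaw ρ k] G k := by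
  have h : ∀ k : ℕ, ∃ g : Circle → ℂ, Measurable g ∧
      (1 ≤ k → rootAverage F k =ᵐ[productLaw ρ k] g) := fun k => by
    by_cases hk : 1 ≤ k
    · have hm := (hF ⟨k, hk⟩).aestronglyMeasurable
      exact ⟨hm.mk _, hm.stronglyMeasurable_mk.measurable, fun _ => hm.ae_eq_mk⟩
    · exact ⟨0, measurable_zero, fun h => absurd h hk⟩
  choose G hG hGF using h
  exact ⟨G, hG, hGF⟩

lemma summable_mul_integral_norm (hg : ClassEF r ϑ γ (genSeries θ))
    (hsum : Summable fun k : ℕ+ => (k : ℝ) ^ max (1 - ϑ) 0 *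
      ∫ y, ‖rootAverage F k y‖ ∂(productLaw ρ k)) :
    Summable fun k : ℕ+ => θ k * r ^ (k : ℕ) * ∫ y, ‖rootAverage F k y‖ ∂(productLaw ρ k) := by
  obtain ⟨A, hA⟩ := exists_bound_mul_pow hg
  refine Summable.of_norm_bounded (hsum.mul_left A) fun k => ?_
  have hI : 0 ≤ ∫ y, ‖rootAverage F k y‖ ∂(productLaw ρ k) :=
    integral_nonneg fun _ => norm_nonneg _
  have hA0 : 0 ≤ A := (abs_nonneg _).trans (hA 0)
  rw [norm_mul, Real.norm_eq_abs, Real.norm_of_nonneg hI, ← mul_assoc]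
  refine mul_le_mul_of_nonneg_right ((hA k).trans ?_) hI
  refine le_mul_of_one_le_right hA0 (Real.one_le_rpow ?_ (le_max_right _ _))
  exact_mod_cast k.pos

/-- The characteristic function of the summands of index `k`. -/
noncomputable def blockChar (G : ℕ → Circle → ℂ) (ρ : Measure Circle) (t : ℂ) (k : ℕ) : ℂ :=
  ∫ y, unitChar t (k * G k y) ∂(productLaw ρ k)

/-- Since `x ↦ exp(i⟨x, t⟩)` is Lipschitz with constant `|t|`, the bound is linear in `k`; this
factor later cancels the `1 / k` in the Poisson parameter. -/
lemma norm_blockChar_sub_one_le [IsProbabilityMeasure ρ] {G : ℕ → Circle → ℂ}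
    (hG : ∀ k, Measurable (G k))
    (hF : ∀ k : ℕ+, Integrable (rootAverage F k) (productLaw ρ k))
    (hGF : ∀ k : ℕ, 1 ≤ k → rootAverage F k =ᵐ[productLaw ρ k] G k) (t : ℂ) (k : ℕ+) :
    ‖blockChar G ρ t k - 1‖ ≤ ‖t‖ * k * ∫ y, ‖rootAverage F k y‖ ∂(productLaw ρ k) := by
  have hae := hGF k k.pos
  have hint : Integrable (fun y => unitChar t ((k : ℕ) * G k y)) (productLaw ρ k) :=
    Integrable.of_bound ((measurable_unitChar t).comp ((hG k).const_mul _)).aestronglyMeasurable 1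
      (Eventually.of_forall fun y => (norm_unitChar t _).le)
  have h1 : blockChar G ρ t k - 1 =
      ∫ y, (unitChar t ((k : ℕ) * G k y) - 1) ∂(productLaw ρ k) := by
    rw [integral_sub hint (integrable_const 1)]
    simp [blockChar]
  have hGint : Integrable (G k) (productLaw ρ k) := (hF k).congr hae
  have hn : ∫ y, ‖rootAverage F k y‖ ∂(productLaw ρ k) = ∫ y, ‖G k y‖ ∂(productLaw ρ k) :=
    integral_congr_ae (hae.mono fun y hy => by simp only [hy])
  rw [h1, hn, ← integral_const_mul]
  refine norm_integral_le_of_norm_le (hGint.norm.const_mul _) (Eventually.of_forall fun y => ?_)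
  refine (norm_unitChar_sub_one_le t _).trans (le_of_eq ?_)
  rw [norm_mul, Complex.norm_natCast]
  ring

/-- The weighted summability of the perturbation of the cycle weights. -/
lemma summable_weight_blockChar [IsProbabilityMeasure ρ] (hg : ClassEF r ϑ γ (genSeries θ))
    {G : ℕ → Circle → ℂ} (hG : ∀ k, Measurable (G k))
    (hF : ∀ k : ℕ+, Integrable (rootAverage F k) (productLaw ρ k))
    (hGF : ∀ k : ℕ, 1 ≤ k → rootAverage F k =ᵐ[productLaw ρ k] G k)
    (hsum : Summable fun k : ℕ+ => (k : ℝ) ^ max (1 - ϑ) 0 *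
      ∫ y, ‖rootAverage F k y‖ ∂(productLaw ρ k)) (t : ℂ) :
    Summable fun n : ℕ => ((n : ℝ) + 1) ^ max (1 - ϑ) 0 *
      ‖((θ n * r ^ n / n : ℝ) : ℂ) * (blockChar G ρ t n - 1)‖ := by
  obtain ⟨A, hA⟩ := exists_bound_mul_pow hg
  have hA0 : 0 ≤ A := (abs_nonneg _).trans (hA 0)
  set p := max (1 - ϑ) 0
  have hp : 0 ≤ p := le_max_right _ _
  rw [← summable_pnat_iff_summable_nat]
  refine Summable.of_nonneg_of_le (fun k => by positivity) (fun k => ?_)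
    (hsum.mul_left (2 ^ p * A * ‖t‖))
  have hk : (1 : ℝ) ≤ (k : ℕ) := by exact_mod_cast k.pos
  have hk0 : (0 : ℝ) < (k : ℕ) := by linarith
  -- For `k ≥ 1` one has `k + 1 ≤ 2 k`, whence the factor `2 ^ p`.
  have h1 : (((k : ℕ) : ℝ) + 1) ^ p ≤ 2 ^ p * ((k : ℕ) : ℝ) ^ p := by
    rw [← Real.mul_rpow (by norm_num) hk0.le]
    exact Real.rpow_le_rpow (by positivity) (by linarith) hp
  have hI : 0 ≤ ∫ y, ‖rootAverage F k y‖ ∂(productLaw ρ k) :=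
    integral_nonneg fun _ => norm_nonneg _
  have h2 : ‖((θ k * r ^ (k : ℕ) / (k : ℕ) : ℝ) : ℂ) * (blockChar G ρ t k - 1)‖ ≤
      A * ‖t‖ * ∫ y, ‖rootAverage F k y‖ ∂(productLaw ρ k) := by
    rw [norm_mul, Complex.norm_real, Real.norm_eq_abs, abs_div, abs_of_pos hk0]
    calc |θ k * r ^ (k : ℕ)| / (k : ℕ) * ‖blockChar G ρ t k - 1‖
        ≤ A / (k : ℕ) * (‖t‖ * (k : ℕ) * ∫ y, ‖rootAverage F k y‖ ∂(productLaw ρ k)) :=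
          mul_le_mul (div_le_div_of_nonneg_right (hA k) hk0.le)
            (norm_blockChar_sub_one_le hG hF hGF t k) (norm_nonneg _) (by positivity)
      _ = _ := by field_simp
  calc _ ≤ (2 ^ p * ((k : ℕ) : ℝ) ^ p) *
        (A * ‖t‖ * ∫ y, ‖rootAverage F k y‖ ∂(productLaw ρ k)) :=
        mul_le_mul h1 h2 (norm_nonneg _) (by positivity)
    _ = _ := by ring

variable {Ω' : Type*} [MeasurableSpace Ω'] {μ' : Measure Ω'}
  {P : ℕ+ → Ω' → ℕ} {Z : ℕ+ → ℕ → Ω' → Circle}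

lemma ae_rootAverage_eq {G : ℕ → Circle → ℂ}
    (hGF : ∀ k : ℕ, 1 ≤ k → rootAverage F k =ᵐ[productLaw ρ k] G k)
    (hZ : ∀ k m, HasLaw (Z k m) (productLaw ρ k) μ') :
    ∀ᵐ ω ∂μ', ∀ (k : ℕ+) (m : ℕ), rootAverage F k (Z k m ω) = G k (Z k m ω) := by
  rw [ae_all_iff]
  intro k
  rw [ae_all_iff]
  intro m
  have h := hGF k k.pos
  rw [← (hZ k m).map_eq] at h
  exact ae_of_ae_map (hZ k m).aemeasurable h

/-- Almost sure absolute convergence of the limiting series. -/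
theorem ae_summable_norm [IsProbabilityMeasure ρ]
    (hθ : ∀ k : ℕ, 1 ≤ k → 0 < θ k) (hg : ClassEF r ϑ γ (genSeries θ))
    (hF : ∀ k : ℕ+, Integrable (rootAverage F k) (productLaw ρ k))
    (hsum : Summable fun k : ℕ+ => (k : ℝ) ^ max (1 - ϑ) 0 *
      ∫ y, ‖rootAverage F k y‖ ∂(productLaw ρ k))
    (hP : ∀ k : ℕ+, HasLaw (P k) (poissonMeasure (θ k * r ^ (k : ℕ) / k).toNNReal) μ')
    (hZ : ∀ k m, HasLaw (Z k m) (productLaw ρ k) μ')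
    (hPZ : IndepFun (fun ω k => P k ω) (fun ω (p : ℕ+ × ℕ) => Z p.1 p.2 ω) μ') :
    ∀ᵐ ω ∂μ', Summable fun k : ℕ+ =>
      ∑ m ∈ Finset.range (P k ω), ‖(k : ℂ) * rootAverage F k (Z k m ω)‖ := by
  obtain ⟨G, hG, hGF⟩ := exists_measurable_version hF
  have hr := hg.r_pos
  have hh : ∀ k : ℕ+, Measurable fun y => ‖(k : ℂ) * G k y‖ₑ := fun k =>
    ((hG k).const_mul _).enorm
  have hmeas : ∀ k, AEMeasurable
      (fun ω => ∑ m ∈ Finset.range (P k ω), ‖(k : ℂ) * G k (Z k m ω)‖ₑ) μ' := fun k =>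
    aemeasurable_sum_range (h := fun y => ‖(k : ℂ) * G k y‖ₑ) (hP k).aemeasurable
      (fun m => (hZ k m).aemeasurable) (hh k)
  -- By Wald's identity the mean is `(θ_k r^k / k) · k E|Δ_k|`; these means are summable because
  -- `θ_k r^k` is bounded.
  have hterm : ∀ k : ℕ+, ∫⁻ ω, ∑ m ∈ Finset.range (P k ω), ‖(k : ℂ) * G k (Z k m ω)‖ₑ ∂μ' =
      ENNReal.ofReal (θ k * r ^ (k : ℕ) *
        ∫ y, ‖rootAverage F k y‖ ∂(productLaw ρ k)) := fun k => by
    have hGint : Integrable (G k) (productLaw ρ k) := (hF k).congr (hGF k k.pos)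
    have hk0 : (0 : ℝ) < (k : ℕ) := by exact_mod_cast k.pos
    have ht := hθ k k.pos
    have hn : ∫ y, ‖rootAverage F k y‖ ∂(productLaw ρ k) = ∫ y, ‖G k y‖ ∂(productLaw ρ k) :=
      integral_congr_ae ((hGF k k.pos).mono fun y hy => by simp only [hy])
    rw [lintegral_sum_range_poisson (Λ := fun k : ℕ+ => (θ k * r ^ (k : ℕ) / k).toNNReal)
      (ν := fun k : ℕ+ => productLaw ρ k) (hP k) (hZ k) hPZ (hh k),
      ← ofReal_integral_norm_eq_lintegral_enorm (hGint.const_mul _), hn]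
    simp only [norm_mul, Complex.norm_natCast]
    rw [integral_const_mul]
    change ENNReal.ofReal _ * _ = _
    rw [← ENNReal.ofReal_mul (by positivity)]
    congr 1
    field_simp
  have hfin : ∫⁻ ω, ∑' k : ℕ+, ∑ m ∈ Finset.range (P k ω), ‖(k : ℂ) * G k (Z k m ω)‖ₑ ∂μ' ≠ ∞ := by
    rw [lintegral_tsum hmeas]
    simp_rw [hterm]
    exact (summable_mul_integral_norm hg hsum).tsum_ofReal_ne_top
  have hlt := ae_lt_top' (AEMeasurable.tsum hmeas) hfin
  filter_upwards [hlt, ae_rootAverage_eq hGF hZ] with ω hω hGω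
  have h1 := ENNReal.summable_toReal hω.ne
  refine h1.congr fun k => ?_
  rw [ENNReal.toReal_sum fun _ _ => enorm_ne_top]
  exact Finset.sum_congr rfl fun m _ => by rw [hGω, toReal_enorm]

/-- The characteristic function of the limit. -/
theorem charFun_limitSum [IsProbabilityMeasure ρ] [IsProbabilityMeasure μ']
    (hθ : ∀ k : ℕ, 1 ≤ k → 0 < θ k) (hg : ClassEF r ϑ γ (genSeries θ))
    {G : ℕ → Circle → ℂ} (hG : ∀ k, Measurable (G k))
    (hF : ∀ k : ℕ+, Integrable (rootAverage F k) (productLaw ρ k))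
    (hGF : ∀ k : ℕ, 1 ≤ k → rootAverage F k =ᵐ[productLaw ρ k] G k)
    (hsum : Summable fun k : ℕ+ => (k : ℝ) ^ max (1 - ϑ) 0 *
      ∫ y, ‖rootAverage F k y‖ ∂(productLaw ρ k))
    (hP : ∀ k : ℕ+, HasLaw (P k) (poissonMeasure (θ k * r ^ (k : ℕ) / k).toNNReal) μ')
    (hZ : ∀ k m, HasLaw (Z k m) (productLaw ρ k) μ')
    (hP_indep : iIndepFun P μ')
    (hZ_indep : iIndepFun (fun p : ℕ+ × ℕ => Z p.1 p.2) μ')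
    (hPZ : IndepFun (fun ω k => P k ω) (fun ω (p : ℕ+ × ℕ) => Z p.1 p.2 ω) μ') :
    AEMeasurable (limitSum F P Z) μ' ∧
    ∀ t : ℂ, charFun (μ'.map (limitSum F P Z)) t =
      Complex.exp (∑' n : ℕ, ((θ n * r ^ n / n : ℝ) : ℂ) * (blockChar G ρ t n - 1)) := by
  have hr := hg.r_pos
  have hae := ae_rootAverage_eq hGF hZ
  have hterm : ∀ k, AEMeasurable (limitTerm F P Z k) μ' := fun k => by
    refine (aemeasurable_sum_range (h := fun y => (k : ℂ) * G k y) (hP k).aemeasurable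
      (fun m => (hZ k m).aemeasurable) ((hG k).const_mul _)).congr ?_
    filter_upwards [hae] with ω hω
    exact Finset.sum_congr rfl fun m _ => by rw [hω]
  have hpart : ∀ s : Finset ℕ+, AEMeasurable (fun ω => ∑ k ∈ s, limitTerm F P Z k ω) μ' :=
    fun s => Finset.aemeasurable_fun_sum s fun k _ => hterm k
  have hlim : ∀ᵐ ω ∂μ', Tendsto (fun s : Finset ℕ+ => ∑ k ∈ s, limitTerm F P Z k ω) atTop
      (𝓝 (limitSum F P Z ω)) := by
    filter_upwards [ae_summable_norm hθ hg hF hsum hP hZ hPZ] with ω hω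
    exact (Summable.of_norm_bounded hω fun k => norm_sum_le _ _).hasSum
  have hY := aemeasurable_of_tendsto_metrizable_ae atTop hpart hlim
  refine ⟨hY, fun t => ?_⟩
  rw [charFun_map_eq hY]
  -- Partial sums over finite sets of indices converge almost surely, and characters are bounded by
  -- `1`, so dominated convergence applies.
  have hT1 : Tendsto (fun s : Finset ℕ+ => ∫ ω, unitChar t (∑ k ∈ s, limitTerm F P Z k ω) ∂μ')
      atTop (𝓝 (∫ ω, unitChar t (limitSum F P Z ω) ∂μ')) := by
    refine tendsto_integral_filter_of_dominated_convergence (fun _ => 1)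
      (Eventually.of_forall fun s =>
        ((measurable_unitChar t).comp_aemeasurable (hpart s)).aestronglyMeasurable)
      (Eventually.of_forall fun s => Eventually.of_forall fun ω => (norm_unitChar t _).le)
      (integrable_const 1) ?_
    filter_upwards [hlim] with ω hω
    exact ((continuous_unitChar t).tendsto _).comp hω
  have hfinite : ∀ s : Finset ℕ+, ∫ ω, unitChar t (∑ k ∈ s, limitTerm F P Z k ω) ∂μ' =
      Complex.exp (∑ k ∈ s, ((θ k * r ^ (k : ℕ) / (k : ℕ) : ℝ) : ℂ) *
        (blockChar G ρ t k - 1)) := fun s => by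
    rw [Complex.exp_sum]
    have h1 := integral_prod_prod_range (Λ := fun k : ℕ+ => (θ k * r ^ (k : ℕ) / k).toNNReal)
      (ν := fun k : ℕ+ => productLaw ρ k) hP hZ hP_indep hZ_indep hPZ
      (u := fun k y => unitChar t ((k : ℕ) * G k y))
      (fun k => (measurable_unitChar t).comp ((hG k).const_mul _))
      (fun k y => (norm_unitChar t _).le) s
    have h2 : ∫ ω, unitChar t (∑ k ∈ s, limitTerm F P Z k ω) ∂μ' =
        ∫ ω, ∏ k ∈ s, ∏ m ∈ Finset.range (P k ω), unitChar t ((k : ℕ) * G k (Z k m ω)) ∂μ' := by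
      refine integral_congr_ae ?_
      filter_upwards [hae] with ω hω
      simp only [limitTerm, unitChar_sum, hω]
    rw [h2, h1]
    refine Finset.prod_congr rfl fun k _ => ?_
    have hk0 : (0 : ℝ) < (k : ℕ) := by exact_mod_cast k.pos
    have ht := hθ k k.pos
    have h3 : (((θ k * r ^ (k : ℕ) / (k : ℕ)).toNNReal : ℝ) : ℂ) =
        ((θ k * r ^ (k : ℕ) / (k : ℕ) : ℝ) : ℂ) := by
      rw [Real.coe_toNNReal _ (by positivity)]
    rw [h3]
    rfl
  have hs1 : Summable fun n : ℕ => ((θ n * r ^ n / n : ℝ) : ℂ) * (blockChar G ρ t n - 1) :=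
    Summable.of_norm_bounded (summable_weight_blockChar hg hG hF hGF hsum t) fun n =>
      le_mul_of_one_le_left (norm_nonneg _) (Real.one_le_rpow
        (by linarith [Nat.cast_nonneg (α := ℝ) n]) (le_max_right _ _))
  -- The index `0`, absent from the limit series, contributes nothing because of the division by `n
  -- = 0`.
  have hs2 : HasSum (fun k : ℕ+ => ((θ k * r ^ (k : ℕ) / (k : ℕ) : ℝ) : ℂ) *
      (blockChar G ρ t k - 1))
      (∑' n : ℕ, ((θ n * r ^ n / n : ℝ) : ℂ) * (blockChar G ρ t n - 1)) := by
    refine (PNat.coe_injective.hasSum_iff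
      (f := fun n : ℕ => ((θ n * r ^ n / n : ℝ) : ℂ) * (blockChar G ρ t n - 1)) ?_).2 hs1.hasSum
    intro n hn
    have : n = 0 := by
      by_contra h
      exact hn ⟨⟨n, Nat.pos_of_ne_zero h⟩, rfl⟩
    simp [this]
  simp_rw [hfinite] at hT1
  exact tendsto_nhds_unique hT1 ((Complex.continuous_exp.tendsto _).comp hs2)

end Limit

end WreathTrace

/-! ### Convergence in law from convergence of characteristic functions. -/

theorem mainTheorem6
    -- the weights and the class of their generating series
    (θ : ℕ → ℝ) (hθ : ∀ k : ℕ, 1 ≤ k → 0 < θ k)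
    (r ϑ γ : ℝ) (hϑ : 0 < ϑ)
    (hg : WreathTrace.ClassEF r ϑ γ (WreathTrace.genSeries θ))
    -- the law of the entries, and the function
    (ρ : Measure Circle) [IsProbabilityMeasure ρ]
    (F : Circle → ℂ)
    (hF : ∀ k : ℕ+,
      Integrable (WreathTrace.rootAverage F k) (WreathTrace.productLaw ρ k))
    (hsum : Summable fun k : ℕ+ =>
      (k : ℝ) ^ max (1 - ϑ) 0 *
        ∫ y, ‖WreathTrace.rootAverage F k y‖ ∂(WreathTrace.productLaw ρ k))
    -- for each `N`, a random permutation and independent i.i.d. random variables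
    {Ω : ℕ → Type*} [∀ N, MeasurableSpace (Ω N)]
    (μ : ∀ N, Measure (Ω N)) [∀ N, IsProbabilityMeasure (μ N)]
    (σ : ∀ N, Ω N → Equiv.Perm (Fin N)) (z : ∀ N, Fin N → Ω N → Circle)
    (hσ : ∀ N, HasLaw (σ N) (WreathTrace.ewensMeasure θ N) (μ N))
    (hz : ∀ N j, HasLaw (z N j) ρ (μ N))
    (hz_indep : ∀ N, iIndepFun (z N) (μ N))
    (hσz : ∀ N, IndepFun (σ N) (fun ω j => z N j ω) (μ N))
    -- the random variables that enter the limit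
    {Ω' : Type*} [MeasurableSpace Ω'] (μ' : Measure Ω') [IsProbabilityMeasure μ']
    (P : ℕ+ → Ω' → ℕ) (Z : ℕ+ → ℕ → Ω' → Circle)
    (hP : ∀ k : ℕ+, HasLaw (P k) (poissonMeasure (θ k * r ^ (k : ℕ) / k).toNNReal) μ')
    (hZ : ∀ k m, HasLaw (Z k m) (WreathTrace.productLaw ρ k) μ')
    (hP_indep : iIndepFun P μ')
    (hZ_indep : iIndepFun (fun p : ℕ+ × ℕ => Z p.1 p.2) μ')
    (hPZ : IndepFun (fun ω k => P k ω) (fun ω (p : ℕ+ × ℕ) => Z p.1 p.2 ω) μ') :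
    (∀ᵐ ω ∂μ', Summable fun k : ℕ+ =>
      ∑ m ∈ Finset.range (P k ω), ‖(k : ℂ) * WreathTrace.rootAverage F k (Z k m ω)‖) ∧
    TendstoInDistribution
      (fun N ω => WreathTrace.wreathTrace F (σ N ω) (fun j => z N j ω)) atTop
      (WreathTrace.limitSum F P Z) μ μ' := by
  refine ⟨WreathTrace.ae_summable_norm hθ hg hF hsum hP hZ hPZ, ?_⟩
  obtain ⟨G, hG, hGF⟩ := WreathTrace.exists_measurable_version hF
  have htr := fun N =>
    WreathTrace.charFun_wreathTrace hθ hG hGF (hσ N) (hz N) (hz_indep N) (hσz N)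
  have hlim := WreathTrace.charFun_limitSum hθ hg hG hF hGF hsum hP hZ hP_indep hZ_indep hPZ
  refine ⟨fun N => (htr N).1, hlim.1,
    ProbabilityMeasure.tendsto_iff_tendsto_charFun.2 fun t => ?_⟩
  simp only [ProbabilityMeasure.coe_mk]
  rw [hlim.2 t]
  simp_rw [fun N => (htr N).2 t]
  exact WreathTrace.tendsto_permAverage_div hθ hϑ hg (WreathTrace.blockChar G ρ t)
    (WreathTrace.summable_weight_blockChar hg hG hF hGF hsum t)
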